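/- Let $\Omega=\mathbb T^2=\mathbb R^2/\mathbb Z^2$ be the two-dimensional torus (the square $[0,1]^2$ with periodic boundary conditions) and let $\alpha>0$. Let $\dot H^1(\Omega)=\{u\in L^2(\Omega):\nabla u\in L^2(\Omega)^2,\ \int_\Omega u\,dx=0\}$ be the space of real-valued mean-zero Sobolev functions, with norm $\left(\|u\|_{L^2}^2+\|\nabla u\|_{L^2}^2\right)^{1/2}$, and let $\dot H^{-1}(\Omega)$ be its dual space. For $u\in\dot H^1(\Omega)$ the element $(1-\alpha^2\Delta)u$ of $\dot H^{-1}(\Omega)$ is given by $\langle(1-\alpha^2\Delta)u,\varphi\rangle=\int_\Omega\left(u\varphi+\alpha^2\nabla u\cdot\nabla\varphi\right)dx$, and for $w\in L^2(\Omega)^2$ the relation $F=\operatorname{div}(uw)$ in $\dot H^{-1}(\Omega)$ means that, for every $\varphi\in\dot H^1(\Omega)$, $u\,w\cdot\nabla\varphi$ is integrable and $\langle F,\varphi\rangle=-\int_\Omega u\,w\cdot\nabla\varphi\,dx$. The operator $(-\Delta)^{1/2}$ is the Fourier multiplier which multiplies the coefficient of $e^{2\pi i k\cdot x}$, $k\in\mathbb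 Z^2$, by $2\pi|k|$, and $\nabla^\perp\psi=(-\partial_{x_2}\psi,\partial_{x_1}\psi)$. Theorem. For every $\theta_0\in\dot H^1(\Omega)$ the initial value problem $$(1-\alpha^2\Delta)\theta=\tilde\theta,\qquad \partial_t\tilde\theta=-\operatorname{div}(\theta v),\qquad v=\nabla^\perp\psi,\quad(-\Delta)^{1/2}\psi=\theta,\quad\int_\Omega\psi\,dx=0,\qquad\theta(0)=\theta_0,$$ where $\theta(t),\psi(t)\in\dot H^1(\Omega)$ and the evolution equation holds in $\dot H^{-1}(\Omega)$ for every $t\in\mathbb R$, with $\partial_t\tilde\theta$ the derivative with respect to the norm of $\dot H^{-1}(\Omega)$, has a unique global solution $(\theta,\tilde\theta,\psi,v)$. It satisfies $\theta\in C^1((-\infty,\infty),\dot H^1(\Omega))$ and $\tilde\theta\in C^1((-\infty,\infty),\dot H^{-1}(\Omega))$, and the modified energy is conserved: for all $t\in\mathbb R$, $$\int_\Omega\left(\theta(t)^2+\alpha^2|\nabla\theta(t)|^2\right)dx=\int_\Omega\left(\theta_0^2+\alpha^2|\nabla\theta_0|^2\right)dx.$$ -/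

import Mathlib

open MeasureTheory
open scoped ContDiff

noncomputable section

namespace SQG

/-- The two-dimensional torus `ℝ² / ℤ²`, i.e. the square `[0,1]²` with periodic boundary
conditions. -/
abbrev Torus : Type := UnitAddTorus (Fin 2)

/-- The Lebesgue measure of the torus, of total mass one. -/
abbrev μ : Measure Torus := Measure.pi fun _ : Fin 2 => AddCircle.haarAddCircle

/-- Real-valued square integrable functions on the torus. -/
abbrev L2 : Type := Lp ℝ 2 μ

/-- Square integrable vector fields on the torus. -/
abbrev L2Vec : Type := PiLp 2 fun _ : Fin 2 => L2

/-- The covering map `ℝ² → ℝ² / ℤ²`. -/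
def proj (x : Fin 2 → ℝ) : Torus := fun i => (x i : UnitAddCircle)

/-- A function on the torus is smooth if the corresponding periodic function on `ℝ²` is. -/
def IsSmooth (f : Torus → ℝ) : Prop := ContDiff ℝ ∞ fun x => f (proj x)

/-- The classical partial derivative `∂ᵢ f` of a function on the torus. -/
def partialDeriv (i : Fin 2) (f : Torus → ℝ) (x : Torus) : ℝ :=
  deriv (fun s : ℝ => f (x + Pi.single i (s : UnitAddCircle))) 0

/-- `g` is the weak partial derivative `∂ᵢ u` on the torus:
`∫ u ∂ᵢφ = - ∫ g φ` for all smooth (periodic) test functions `φ`. -/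
def IsWeakDeriv (i : Fin 2) (u g : L2) : Prop :=
  ∀ φ : Torus → ℝ, IsSmooth φ → ∫ x, u x * partialDeriv i φ x ∂μ = -∫ x, g x * φ x ∂μ

lemma isOpenQuotientMap_proj : IsOpenQuotientMap proj :=
  IsOpenQuotientMap.piMap (f := fun (_ : Fin 2) (s : ℝ) => (s : UnitAddCircle))
    fun _ => QuotientAddGroup.isOpenQuotientMap_mk

lemma IsSmooth.continuous {f : Torus → ℝ} (hf : IsSmooth f) : Continuous f :=
  isOpenQuotientMap_proj.isQuotientMap.continuous_iff.2 (ContDiff.continuous hf)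

lemma IsSmooth.continuous_partialDeriv {f : Torus → ℝ} (hf : IsSmooth f) (i : Fin 2) :
    Continuous (partialDeriv i f) := by
  refine isOpenQuotientMap_proj.isQuotientMap.continuous_iff.2 ?_
  have h : partialDeriv i f ∘ proj =
      fun x => fderiv ℝ (fun y => f (proj y)) x (Pi.single i 1) := by
    funext x
    have h1 : HasDerivAt (fun s : ℝ => x + s • (Pi.single i 1 : Fin 2 → ℝ))
        (Pi.single i 1) 0 := by
      simpa using ((hasDerivAt_id (0 : ℝ)).smul_const (Pi.single i 1 : Fin 2 → ℝ)).const_add x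
    have h2 : HasFDerivAt (fun y => f (proj y)) (fderiv ℝ (fun y => f (proj y)) x)
        (x + (0 : ℝ) • (Pi.single i 1 : Fin 2 → ℝ)) := by
      rw [zero_smul, add_zero]
      exact (ContDiff.differentiable hf (by simp) x).hasFDerivAt
    rw [← (h2.comp_hasDerivAt (0 : ℝ) h1).deriv]
    simp only [partialDeriv, Function.comp_def]
    congr 1
    funext s
    congr 1
    funext j
    by_cases hj : j = i
    · subst hj; simp [proj]
    · simp [proj, hj]
  rw [h]
  exact (ContDiff.continuous_fderiv hf (by simp)).clm_apply continuous_const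

lemma integrable_mul (u : L2) {f : Torus → ℝ} (hf : Continuous f) :
    Integrable (fun x => u x * f x) μ := by
  obtain ⟨C, hC⟩ := (isCompact_univ (X := Torus)).exists_bound_of_continuousOn hf.continuousOn
  exact ((Lp.memLp u).integrable (by norm_num)).mul_bdd (c := C)
    hf.aestronglyMeasurable (Filter.Eventually.of_forall fun x => hC x (Set.mem_univ x))

/-- The space `Ḣ¹` of mean-zero real functions on the torus with square integrable weak gradient.
An element is a function together with its weak gradient `(u, (∂₀u, ∂₁u))`, and the norm is the
Sobolev norm `(‖u‖² + ‖∇u‖²) ^ (1/2)` with `L²` norms on the right. -/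
def H1dot : Submodule ℝ (WithLp 2 (L2 × L2Vec)) where
  carrier := {u | ∫ x, u.fst x ∂μ = 0 ∧ ∀ i, IsWeakDeriv i u.fst (u.snd i)}
  zero_mem' := by
    exact ⟨by simp, fun i φ _ => by simp⟩
  add_mem' := by
    rintro u v ⟨hu0, hu⟩ ⟨hv0, hv⟩
    have key : ∀ (a b : L2) (f : Torus → ℝ), Continuous f →
        ∫ x, (a + b : L2) x * f x ∂μ = ∫ x, a x * f x ∂μ + ∫ x, b x * f x ∂μ := by
      intro a b f hf
      rw [← integral_add (integrable_mul a hf) (integrable_mul b hf)]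
      refine integral_congr_ae ?_
      filter_upwards [Lp.coeFn_add a b] with x hx
      rw [hx, Pi.add_apply, add_mul]
    refine ⟨?_, fun i φ hφ => ?_⟩
    · have := key u.fst v.fst (fun _ => 1) continuous_const
      simp only [mul_one] at this
      rw [WithLp.add_fst, this, hu0, hv0, add_zero]
    · rw [WithLp.add_fst, WithLp.add_snd, PiLp.add_apply,
        key _ _ _ (hφ.continuous_partialDeriv i), key _ _ _ hφ.continuous, hu i φ hφ, hv i φ hφ]
      ring
  smul_mem' := by
    rintro c u ⟨hu0, hu⟩
    have key : ∀ (a : L2) (f : Torus → ℝ),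
        ∫ x, (c • a : L2) x * f x ∂μ = c * ∫ x, a x * f x ∂μ := by
      intro a f
      rw [← integral_const_mul]
      refine integral_congr_ae ?_
      filter_upwards [Lp.coeFn_smul c a] with x hx
      simp [hx, mul_assoc]
    refine ⟨?_, fun i φ hφ => ?_⟩
    · have := key u.fst (fun _ => 1)
      simp only [mul_one] at this
      rw [WithLp.smul_fst, this, hu0, mul_zero]
    · rw [WithLp.smul_fst, WithLp.smul_snd, PiLp.smul_apply, key, key, hu i φ hφ]
      ring

/-- The dual space `Ḣ⁻¹` of `Ḣ¹`, with the dual norm. -/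
abbrev Hm1dot : Type := StrongDual ℝ H1dot

/-- The inclusion `Ḣ¹ → L²`. -/
def toL2 : H1dot →L[ℝ] L2 := (WithLp.fstL 2 ℝ L2 L2Vec).comp H1dot.subtypeL

/-- The gradient `∇ : Ḣ¹ → L² × L²`. -/
def grad : H1dot →L[ℝ] L2Vec := (WithLp.sndL 2 ℝ L2 L2Vec).comp H1dot.subtypeL

/-- The operator `1 - α² Δ : Ḣ¹ → Ḣ⁻¹`, that is
`⟨(1 - α² Δ) u, φ⟩ = ∫ u φ + α² ∫ ∇u · ∇φ`. -/
def helmholtz (α : ℝ) : H1dot →L[ℝ] Hm1dot :=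
  (isBoundedBilinearMap_inner (𝕜 := ℝ)).toContinuousLinearMap.bilinearComp toL2 toL2 +
    α ^ 2 • (isBoundedBilinearMap_inner (𝕜 := ℝ)).toContinuousLinearMap.bilinearComp grad grad

lemma helmholtz_apply (α : ℝ) (u φ : H1dot) :
    helmholtz α u φ = inner ℝ (toL2 u) (toL2 φ) + α ^ 2 * inner ℝ (grad u) (grad φ) := rfl

/-- `F = div (u w)` in `Ḣ⁻¹`: `⟨F, φ⟩ = - ∫ u w · ∇φ` for all `φ` in `Ḣ¹`. -/
def IsDiv (u : L2) (w : L2Vec) (F : Hm1dot) : Prop :=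
  ∀ φ : H1dot, Integrable (fun x => u x * ∑ i, w i x * grad φ i x) μ ∧
    F φ = -∫ x, u x * ∑ i, w i x * grad φ i x ∂μ

/-- The equation `(-Δ)^{1/2} ψ = u`: the Fourier coefficients satisfy `|2πk| ψ̂(k) = û(k)`
for all `k` in `ℤ²`. -/
def IsHalfLaplacian (ψ u : L2) : Prop :=
  ∀ k : Fin 2 → ℤ,
    ((2 * Real.pi * √(∑ i, (k i : ℝ) ^ 2) : ℝ) : ℂ) *
        UnitAddTorus.mFourierCoeff (fun x => (ψ x : ℂ)) k =
      UnitAddTorus.mFourierCoeff (fun x => (u x : ℂ)) k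

/-- The rotated gradient `∇^⊥ ψ = (-∂₁ψ, ∂₀ψ)`, with coordinates numbered `0, 1`. -/
def perpGrad (ψ : H1dot) : L2Vec := WithLp.toLp 2 ![-(grad ψ 1), grad ψ 0]

/-- The modified energy `∫ (u² + α² |∇u|²)`. -/
def energy (α : ℝ) (u : H1dot) : ℝ :=
  ∫ x, ((toL2 u x) ^ 2 + α ^ 2 * ∑ i, (grad u i x) ^ 2) ∂μ

/-- `(θ, θt, ψ, v)` is a solution, for all times in `ℝ`, of the inviscid regularization of the
surface quasi-geostrophic equations with initial value `θ₀`: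
`(1 - α² Δ) θ = θt`, `∂ₜ θt = - div (θ v)`, `v = ∇^⊥ ψ`, `(-Δ)^{1/2} ψ = θ`, `∫ ψ = 0`,
`θ(0) = θ₀`. The time derivative is the derivative of a function with values in the normed space
`Ḣ⁻¹`; `∫ ψ = 0` is part of `ψ(t) ∈ Ḣ¹`. -/
structure IsSolution (α : ℝ) (θ₀ : H1dot) (θ : ℝ → H1dot) (θt : ℝ → Hm1dot) (ψ : ℝ → H1dot)
    (v : ℝ → L2Vec) : Prop where
  helmholtz_eq : ∀ t, helmholtz α (θ t) = θt t
  evolution : ∀ t, ∃ F : Hm1dot, IsDiv (toL2 (θ t)) (v t) F ∧ HasDerivAt θt (-F) t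
  velocity : ∀ t, v t = perpGrad (ψ t)
  stream : ∀ t, IsHalfLaplacian (toL2 (ψ t)) (toL2 (θ t))
  initial : θ 0 = θ₀

end SQG

end

/-!
The unknowns `θt`, `ψ`, `v` are determined by `θ`, and the system is the ordinary differential
equation `θ' = B(θ, θ)` in the Hilbert space `Ḣ¹`, with
`B(u, w) = -(1 - α² Δ)⁻¹ div (u ∇^⊥ (-Δ)^{-1/2} w)`: no derivative is lost, because
`(1 - α² Δ)⁻¹` gains two derivatives. Three facts carry the proof.

* `B` is a bounded bilinear map (`nonlinearity`). The velocity of `w` consists of Riesz transforms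
  of `w`, which are Fourier multipliers with symbols bounded by one and so act on `Ḣ¹` (`velocity`).
  The product of two elements of `Ḣ¹` is in `L²` since `Ḣ¹` embeds into `L⁴` (`eLpNorm_four_le`).
  For smooth `u` this is seen in Fourier space: `‖u‖₄⁴ = ‖u²‖₂²`, the coefficients of `u²` are
  `∑ⱼ û(j) û(k - j)`, and by the Cauchy-Schwarz inequality with the weights `1 + 4π²|k|²` their
  `ℓ²` norm is bounded by `‖u‖²`, as `∑ (1 + 4π²|k|²)⁻²` converges over `ℤ²`
  (`tsum_convolution_sq_le`). Finally `1 - α² Δ` is an isomorphism `Ḣ¹ → Ḣ⁻¹` by the Lax-Milgram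
  theorem (`helmholtzEquiv`).
* The energy `⟨(1 - α² Δ) θ, θ⟩` is conserved: its derivative is
  `2 ∫ θ v · ∇θ = ∫ v · ∇(θ²) = 0`, as `v` is divergence free (`flux_self`). For smooth `θ` the
  square `θ²` is a test function; smooth functions are dense in `Ḣ¹` (`dense_smoothH1`).
* A quadratic differential equation with a coercive conserved energy has unique global solutions
  (`exists_global_solution`, `solution_unique`). If the field is multiplied by a cutoff function of
  `‖θ‖` it becomes bounded and globally Lipschitz, so that its solutions are global; the energy is
  still conserved and keeps the solution in the region where the cutoff function is one.

The link between the weak formulation and Fourier space is `isWeakDeriv_iff`: `g` is the weak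
derivative `∂ᵢ u` if and only if `ĝ(k) = 2πi kᵢ û(k)` for all `k`.
-/

noncomputable section

-- Instances on spaces of multilinear operators such as `H1dot →L[ℝ] Hm1dot` are nested too deeply
-- for the default value.
set_option maxSynthPendingDepth 3

namespace SQG

open UnitAddTorus
open scoped ComplexConjugate ENNReal

/-! ### Fourier coefficients of real square integrable functions -/

/-- The sequence space `ℓ²(ℤ²)` of complex Fourier coefficients. -/
abbrev FourierSeq : Type := lp (fun _ : Fin 2 → ℤ => ℂ) 2

/-- The isometry `L²(𝕋², ℂ) ≃ ℓ²(ℤ²)` given by the Fourier coefficients. -/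
def fourierEquiv : Lp ℂ 2 μ ≃ₗᵢ[ℂ] FourierSeq := (mFourierBasis (d := Fin 2)).repr

lemma fourierEquiv_apply (f : Lp ℂ 2 μ) (k : Fin 2 → ℤ) :
    fourierEquiv f k = ∫ x, mFourier (-k) x * f x ∂μ :=
  mFourierBasis_repr f k

/-- The Fourier coefficients of a real square integrable function. -/
def coeffs : L2 →L[ℝ] FourierSeq :=
  (fourierEquiv.toContinuousLinearEquiv.toContinuousLinearMap.restrictScalars ℝ).comp
    (Complex.ofRealCLM.compLpL 2 μ)

lemma coeFn_ofReal (u : L2) : Complex.ofRealCLM.compLpL 2 μ u =ᵐ[μ] fun x => (u x : ℂ) :=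
  Complex.ofRealCLM.coeFn_compLp u

/-- The Fourier coefficient `û(k)` of a real square integrable function. -/
def coeff (u : L2) (k : Fin 2 → ℤ) : ℂ := coeffs u k

lemma coeff_eq_integral (u : L2) (k : Fin 2 → ℤ) :
    coeff u k = ∫ x, mFourier (-k) x * (u x : ℂ) ∂μ := by
  refine (fourierEquiv_apply _ k).trans (integral_congr_ae ?_)
  filter_upwards [coeFn_ofReal u] with x hx
  exact congrArg _ hx

lemma coeff_eq_mFourierCoeff (u : L2) (k : Fin 2 → ℤ) :
    coeff u k = mFourierCoeff (fun x => (u x : ℂ)) k :=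
  coeff_eq_integral u k

lemma coeff_neg (u : L2) (k : Fin 2 → ℤ) : coeff u (-k) = conj (coeff u k) := by
  rw [coeff_eq_integral, coeff_eq_integral, ← integral_conj]
  congr 1
  funext x
  rw [map_mul, Complex.conj_ofReal, mFourier_neg (n := k), mFourier_neg (n := -k),
    mFourier_neg (n := k)]

lemma coeffs_injective : Function.Injective coeffs := by
  intro u w h
  have h' : Complex.ofRealCLM.compLpL 2 μ u = Complex.ofRealCLM.compLpL 2 μ w :=
    fourierEquiv.injective h
  refine Lp.ext ?_
  filter_upwards [coeFn_ofReal u, coeFn_ofReal w] with x hu hw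
  rw [h', hw] at hu
  exact_mod_cast hu.symm

lemma ext_coeff {u w : L2} (h : ∀ k, coeff u k = coeff w k) : u = w :=
  coeffs_injective (lp.ext (funext h))

/-- Parseval's identity for real functions. -/
lemma hasSum_coeff (u w : L2) :
    HasSum (fun k => conj (coeff u k) * coeff w k) ((∫ x, u x * w x ∂μ : ℝ) : ℂ) := by
  have h : inner ℂ (coeffs u) (coeffs w) = ((∫ x, u x * w x ∂μ : ℝ) : ℂ) := by
    refine (fourierEquiv.inner_map_map _ _).trans ?_
    rw [L2.inner_def, ← integral_complex_ofReal]
    refine integral_congr_ae ?_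
    filter_upwards [coeFn_ofReal u, coeFn_ofReal w] with x hu hw
    refine (congrArg₂ (inner ℂ) hu hw).trans ?_
    simp [mul_comm]
  rw [← h]
  refine (lp.hasSum_inner (coeffs u) (coeffs w)).congr_fun fun k => ?_
  exact mul_comm _ _

/-- The class in `L²` of a continuous function. -/
def ofCont (f : Torus → ℝ) (hf : Continuous f) : L2 := ContinuousMap.toLp 2 μ ℝ ⟨f, hf⟩

lemma coeFn_ofCont {f : Torus → ℝ} (hf : Continuous f) : ofCont f hf =ᵐ[μ] f :=
  ContinuousMap.coeFn_toLp μ (𝕜 := ℝ) ⟨f, hf⟩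

lemma coeff_ofCont {f : Torus → ℝ} (hf : Continuous f) (k : Fin 2 → ℤ) :
    coeff (ofCont f hf) k = ∫ x, mFourier (-k) x * (f x : ℂ) ∂μ := by
  rw [coeff_eq_integral]
  refine integral_congr_ae ?_
  filter_upwards [coeFn_ofCont hf] with x hx
  rw [hx]

/-! ### Fourier multipliers -/

/-- The Fourier multiplier with bounded symbol `m`, followed by taking the real part. -/
def fourierMul (m : lp (fun _ : Fin 2 → ℤ => ℂ) ∞) : L2 →L[ℝ] L2 :=
  (Complex.reCLM.compLpL 2 μ).comp
    ((fourierEquiv.symm.toContinuousLinearEquiv.toContinuousLinearMap.restrictScalars ℝ).comp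
      (((lp.holderL 2 (fun _ : Fin 2 → ℤ => ContinuousLinearMap.mul ℂ ℂ) (K := 1)
        (fun _ => ContinuousLinearMap.opNorm_mul_le ℂ ℂ) m).restrictScalars ℝ).comp coeffs))

/-- For a symbol with `m (-k) = conj (m k)` the multiplier maps real functions to real functions,
so that taking the real part changes nothing. -/
lemma coeff_fourierMul {m : lp (fun _ : Fin 2 → ℤ => ℂ) ∞} (hm : ∀ k, m (-k) = conj (m k))
    (u : L2) (k : Fin 2 → ℤ) : coeff (fourierMul m u) k = m k * coeff u k := by
  set g : FourierSeq := lp.holderL 2 (fun _ : Fin 2 → ℤ => ContinuousLinearMap.mul ℂ ℂ) (K := 1)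
        (fun _ => ContinuousLinearMap.opNorm_mul_le ℂ ℂ) m (coeffs u) with hg
  have hgk : ∀ k, g k = m k * coeff u k := fun k => rfl
  set f : Lp ℂ 2 μ := fourierEquiv.symm g with hf
  have hfk : ∀ k, ∫ x, mFourier (-k) x * f x ∂μ = m k * coeff u k := by
    intro k
    rw [← fourierEquiv_apply, hf, LinearIsometryEquiv.apply_symm_apply, hgk]
  have hre : fourierMul m u =ᵐ[μ] fun x => (f x).re := Complex.reCLM.coeFn_compLp f
  have hint : ∀ k, Integrable (fun x => mFourier k x * f x) μ := by
    intro k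
    refine ((Lp.memLp f).integrable (by norm_num)).bdd_mul (c := 1)
      (mFourier k).continuous.aestronglyMeasurable (Filter.Eventually.of_forall fun x => ?_)
    exact ((mFourier k).norm_coe_le_norm x).trans mFourier_norm.le
  have hconj : ∫ x, mFourier (-k) x * conj (f x) ∂μ = m k * coeff u k := by
    have h1 := hfk (-k)
    rw [hm, coeff_neg, ← map_mul] at h1
    rw [← Complex.conj_conj (m k * coeff u k), ← h1, ← integral_conj]
    congr 1
    funext x
    rw [map_mul, ← mFourier_neg, neg_neg]
  have hint' : Integrable (fun x => mFourier (-k) x * conj (f x)) μ := by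
    have h := (Complex.conjCLE.toContinuousLinearMap).integrable_comp (hint k)
    refine h.congr (Filter.Eventually.of_forall fun x => ?_)
    simp [mFourier_neg]
  rw [coeff_eq_integral]
  calc ∫ x, mFourier (-k) x * ((fourierMul m u x : ℝ) : ℂ) ∂μ
      = ∫ x, (1 / 2 : ℂ) * (mFourier (-k) x * f x + mFourier (-k) x * conj (f x)) ∂μ := by
        refine integral_congr_ae ?_
        filter_upwards [hre] with x hx
        rw [hx, Complex.re_eq_add_conj]
        ring
    _ = m k * coeff u k := by
        rw [integral_const_mul, integral_add (hint _) hint', hfk, hconj]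
        ring

/-! ### Trigonometric waves and weak derivatives -/

lemma mFourier_add_single (k : Fin 2 → ℤ) (x : Torus) (i : Fin 2) (s : ℝ) :
    mFourier k (x + Pi.single i (s : UnitAddCircle)) =
      mFourier k x * Complex.exp (2 * Real.pi * Complex.I * k i * s) := by
  have h : ∀ (n : ℤ) (y : UnitAddCircle),
      fourier n (y + (s : UnitAddCircle)) =
        fourier n y * Complex.exp (2 * Real.pi * Complex.I * n * s) := by
    intro n y
    have h1 : (fourier n (y + (s : UnitAddCircle)) : ℂ) =
        fourier n y * fourier n (s : UnitAddCircle) := by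
      simp only [fourier_apply, smul_add, AddCircle.toCircle_add, Circle.coe_mul]
    rw [h1, fourier_coe_apply]
    simp
  simp only [mFourier, ContinuousMap.coe_mk, Fin.prod_univ_two]
  fin_cases i
  · simp [h]; ring
  · simp [h]; ring

/-- The real trigonometric wave `x ↦ Re (z e^{2πi k·x})`. -/
def wave (k : Fin 2 → ℤ) (z : ℂ) (x : Torus) : ℝ := (z * mFourier k x).re

lemma hasDerivAt_mFourier (k : Fin 2 → ℤ) (x : Torus) (i : Fin 2) (s : ℝ) :
    HasDerivAt (fun s : ℝ => mFourier k (x + Pi.single i (s : UnitAddCircle)))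
      (2 * Real.pi * Complex.I * k i * mFourier k (x + Pi.single i (s : UnitAddCircle))) s := by
  simp only [mFourier_add_single]
  have h1 : HasDerivAt (fun s : ℝ => 2 * Real.pi * Complex.I * k i * (s : ℂ))
      (2 * Real.pi * Complex.I * k i) s := by
    simpa using (Complex.ofRealCLM.hasDerivAt (x := s)).const_mul (2 * Real.pi * Complex.I * k i)
  convert! (h1.cexp).const_mul (mFourier k x) using 1
  ring

lemma partialDeriv_wave (i : Fin 2) (k : Fin 2 → ℤ) (z : ℂ) :
    partialDeriv i (wave k z) = wave k (z * (2 * Real.pi * Complex.I * k i)) := by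
  funext x
  have h := Complex.reCLM.hasFDerivAt.comp_hasDerivAt (0 : ℝ)
    ((hasDerivAt_mFourier k x i 0).const_mul z)
  refine h.deriv.trans ?_
  simp [wave, mul_assoc]

lemma isSmooth_wave (k : Fin 2 → ℤ) (z : ℂ) : IsSmooth (wave k z) := by
  have h : (fun x => wave k z (proj x)) = fun x : Fin 2 → ℝ =>
      Complex.reCLM (z * (Complex.exp (2 * Real.pi * Complex.I * k 0 * Complex.ofRealCLM (x 0)) *
        Complex.exp (2 * Real.pi * Complex.I * k 1 * Complex.ofRealCLM (x 1)))) := by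
    funext x
    simp [wave, mFourier, proj, Fin.prod_univ_two]
  unfold IsSmooth
  rw [h]
  fun_prop

lemma integral_mul_wave (u : L2) (k : Fin 2 → ℤ) (z : ℂ) :
    ∫ x, u x * wave k z x ∂μ = (z * coeff u (-k)).re := by
  have hint : Integrable (fun x => mFourier k x * (u x : ℂ)) μ := by
    refine ((Lp.memLp u).integrable (by norm_num)).ofReal.bdd_mul (c := 1)
      (mFourier k).continuous.aestronglyMeasurable (Filter.Eventually.of_forall fun x => ?_)
    exact ((mFourier k).norm_coe_le_norm x).trans mFourier_norm.le
  have h := Complex.reCLM.integral_comp_comm (hint.const_mul z)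
  rw [coeff_eq_integral, neg_neg, ← integral_const_mul]
  refine Eq.trans ?_ h
  congr 1
  funext x
  simp only [wave, Complex.reCLM_apply, ← mul_assoc, Complex.re_mul_ofReal]
  ring

lemma IsSmooth.hasDerivAt {f : Torus → ℝ} (hf : IsSmooth f) (i : Fin 2) (x : Torus) (s : ℝ) :
    HasDerivAt (fun s : ℝ => f (x + Pi.single i (s : UnitAddCircle)))
      (partialDeriv i f (x + Pi.single i (s : UnitAddCircle))) s := by
  obtain ⟨y, rfl⟩ := isOpenQuotientMap_proj.surjective x
  have hd : Differentiable ℝ fun s : ℝ => f (proj y + Pi.single i (s : UnitAddCircle)) := by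
    have h : (fun s : ℝ => f (proj y + Pi.single i (s : UnitAddCircle))) =
        fun s : ℝ => (fun z => f (proj z)) (y + s • (Pi.single i 1 : Fin 2 → ℝ)) := by
      funext s
      simp only
      congr 1
      funext j
      by_cases hj : j = i
      · subst hj; simp [proj]
      · simp [proj, hj]
    rw [h]
    have h1 : Differentiable ℝ fun z => f (proj z) := ContDiff.differentiable hf (by simp)
    exact h1.comp (by fun_prop)
  have h2 := (hd s).hasDerivAt
  convert! h2 using 1
  have h3 : (fun r : ℝ => f (proj y + Pi.single i (s : UnitAddCircle) +
      Pi.single i (r : UnitAddCircle))) = fun r : ℝ =>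
        (fun s : ℝ => f (proj y + Pi.single i (s : UnitAddCircle))) (s + r) := by
    funext r
    simp only [AddCircle.coe_add, Pi.single_add, add_assoc]
  unfold partialDeriv
  rw [h3]
  refine (deriv_comp_const_add
    (f := fun s : ℝ => f (proj y + Pi.single i (s : UnitAddCircle))) s 0).trans ?_
  rw [add_zero]

/-- Integration by parts against `e^{-2πi k·x}`. By translation invariance of the measure,
`∫ e^{-2πi k·x} φ(x + s eᵢ) dx = e^{2πi kᵢ s} ∫ e^{-2πi k·x} φ(x) dx`; the identity is the
derivative of this one at `s = 0`. -/
lemma coeff_partialDeriv {φ : Torus → ℝ} (hφ : IsSmooth φ) (i : Fin 2) (k : Fin 2 → ℤ) :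
    coeff (ofCont _ (hφ.continuous_partialDeriv i)) k =
      2 * Real.pi * Complex.I * k i * coeff (ofCont φ hφ.continuous) k := by
  rw [coeff_ofCont, coeff_ofCont]
  have hcd := hφ.continuous_partialDeriv i
  obtain ⟨C, hC⟩ := (isCompact_univ (X := Torus)).exists_bound_of_continuousOn hcd.continuousOn
  have hc : ∀ s : ℝ, Continuous fun x : Torus => x + Pi.single i (s : UnitAddCircle) :=
    fun s => by fun_prop
  have hcφ := hφ.continuous
  have key := (hasDerivAt_integral_of_dominated_loc_of_deriv_le (μ := μ) (𝕜 := ℝ) (x₀ := (0 : ℝ))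
    (s := Set.univ) (bound := fun _ => C)
    (F := fun s x => mFourier (-k) x * (φ (x + Pi.single i (s : UnitAddCircle)) : ℂ))
    (F' := fun s x => mFourier (-k) x *
      (partialDeriv i φ (x + Pi.single i (s : UnitAddCircle)) : ℂ))
    Filter.univ_mem
    (Filter.Eventually.of_forall fun s => Continuous.aestronglyMeasurable (by
      have := hcφ.comp (hc s); fun_prop))
    (Continuous.integrable_of_hasCompactSupport (by have := hcφ.comp (hc 0); fun_prop)
      (HasCompactSupport.of_compactSpace _))
    (Continuous.aestronglyMeasurable (by have := hcd.comp (hc 0); fun_prop))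
    (Filter.Eventually.of_forall fun x s _ => by
      rw [norm_mul]
      have h1 : ‖mFourier (-k) x‖ ≤ 1 := ((mFourier (-k)).norm_coe_le_norm x).trans mFourier_norm.le
      have h2 := hC (x + Pi.single i (s : UnitAddCircle)) (Set.mem_univ _)
      rw [Complex.norm_real]
      nlinarith [norm_nonneg (partialDeriv i φ (x + Pi.single i (s : UnitAddCircle)))])
    (integrable_const _)
    (Filter.Eventually.of_forall fun x s _ => by
      exact ((hφ.hasDerivAt i x s).ofReal_comp).const_mul _)).2
  have htrans : ∀ s : ℝ,
      ∫ x, mFourier (-k) x * (φ (x + Pi.single i (s : UnitAddCircle)) : ℂ) ∂μ =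
        Complex.exp (2 * Real.pi * Complex.I * k i * s) * ∫ x, mFourier (-k) x * (φ x : ℂ) ∂μ := by
    intro s
    rw [← integral_const_mul]
    rw [← integral_add_right_eq_self (μ := μ)
      (fun x => Complex.exp (2 * Real.pi * Complex.I * k i * s) * (mFourier (-k) x * (φ x : ℂ)))
      (Pi.single i (s : UnitAddCircle))]
    congr 1
    funext x
    rw [mFourier_add_single]
    have : Complex.exp (2 * Real.pi * Complex.I * k i * s) *
        Complex.exp (2 * Real.pi * Complex.I * (-k) i * s) = 1 := by
      rw [← Complex.exp_add]
      simp
    linear_combination (-(mFourier (-k) x * (φ (x + Pi.single i (s : UnitAddCircle)) : ℂ))) * this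
  simp only [htrans] at key
  have h1 : HasDerivAt (fun s : ℝ => 2 * Real.pi * Complex.I * k i * (s : ℂ))
      (2 * Real.pi * Complex.I * k i) 0 := by
    simpa using
      (Complex.ofRealCLM.hasDerivAt (x := (0 : ℝ))).const_mul (2 * Real.pi * Complex.I * k i)
  have h2 := (h1.cexp).mul_const (∫ x, mFourier (-k) x * (φ x : ℂ) ∂μ)
  have h3 := key.unique h2
  simpa using h3

lemma eq_zero_of_forall_re_mul {w : ℂ} (h : ∀ z : ℂ, (z * w).re = 0) : w = 0 := by
  have h1 := h 1
  have h2 := h Complex.I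
  apply Complex.ext <;> simp_all

/-- Weak derivatives are characterized by their Fourier coefficients. -/
lemma isWeakDeriv_iff {i : Fin 2} {u g : L2} :
    IsWeakDeriv i u g ↔ ∀ k, coeff g k = 2 * Real.pi * Complex.I * k i * coeff u k := by
  constructor
  · intro h k
    rw [← sub_eq_zero]
    refine eq_zero_of_forall_re_mul fun z => ?_
    have h1 := h _ (isSmooth_wave (-k) z)
    rw [partialDeriv_wave, integral_mul_wave, integral_mul_wave, neg_neg] at h1
    rw [mul_sub, Complex.sub_re, ← neg_eq_iff_eq_neg.2 h1, ← Complex.neg_re, ← Complex.sub_re]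
    convert Complex.zero_re
    simp
    ring
  · intro h φ hφ
    have h1 := hasSum_coeff u (ofCont _ (hφ.continuous_partialDeriv i))
    have h2 := hasSum_coeff g (ofCont _ hφ.continuous)
    have e1 : ∫ x, u x * (ofCont _ (hφ.continuous_partialDeriv i)) x ∂μ =
        ∫ x, u x * partialDeriv i φ x ∂μ := by
      refine integral_congr_ae ?_
      filter_upwards [coeFn_ofCont (hφ.continuous_partialDeriv i)] with x hx
      rw [hx]
    have e2 : ∫ x, g x * (ofCont _ hφ.continuous) x ∂μ = ∫ x, g x * φ x ∂μ := by
      refine integral_congr_ae ?_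
      filter_upwards [coeFn_ofCont hφ.continuous] with x hx
      rw [hx]
    rw [e1] at h1
    rw [e2] at h2
    have h3 : (fun k => conj (coeff u k) * coeff (ofCont _ (hφ.continuous_partialDeriv i)) k) =
        fun k => -(conj (coeff g k) * coeff (ofCont φ hφ.continuous) k) := by
      funext k
      rw [coeff_partialDeriv hφ, h]
      simp only [map_mul, Complex.conj_I, Complex.conj_ofReal, map_ofNat, map_intCast]
      ring
    rw [h3] at h1
    exact_mod_cast h1.unique h2.neg

/-! ### The Sobolev space: completeness, Fourier multipliers, smooth functions -/

lemma integral_eq_zero_iff (u : L2) : ∫ x, u x ∂μ = 0 ↔ coeff u 0 = 0 := by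
  rw [coeff_eq_integral, neg_zero, mFourier_zero]
  simp only [ContinuousMap.one_apply, one_mul]
  rw [integral_complex_ofReal, Complex.ofReal_eq_zero]

lemma mem_H1dot_iff (u : WithLp 2 (L2 × L2Vec)) :
    u ∈ H1dot ↔ coeff u.fst 0 = 0 ∧
      ∀ i k, coeff (u.snd i) k = 2 * Real.pi * Complex.I * k i * coeff u.fst k := by
  change (_ ∧ _) ↔ _
  rw [integral_eq_zero_iff]
  simp only [isWeakDeriv_iff]

lemma coeff_zero (k : Fin 2 → ℤ) : coeff 0 k = 0 := by
  rw [coeff, map_zero]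
  rfl

lemma continuous_coeff (k : Fin 2 → ℤ) : Continuous fun u : L2 => coeff u k :=
  (lp.evalCLM ℂ (fun _ : Fin 2 → ℤ => ℂ) 2 k).continuous.comp coeffs.continuous

lemma isClosed_H1dot : IsClosed (H1dot : Set (WithLp 2 (L2 × L2Vec))) := by
  have h : (H1dot : Set (WithLp 2 (L2 × L2Vec))) = {u | coeff u.fst 0 = 0 ∧
      ∀ i k, coeff (u.snd i) k = 2 * Real.pi * Complex.I * k i * coeff u.fst k} :=
    Set.ext mem_H1dot_iff
  rw [h]
  have h1 : ∀ k, Continuous fun u : WithLp 2 (L2 × L2Vec) => coeff u.fst k := fun k =>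
    (continuous_coeff k).comp (WithLp.fstL 2 ℝ L2 L2Vec).continuous
  have h2 : ∀ i k, Continuous fun u : WithLp 2 (L2 × L2Vec) => coeff (u.snd i) k := fun i k =>
    (continuous_coeff k).comp
      ((PiLp.proj 2 (fun _ : Fin 2 => L2) i (𝕜 := ℝ)).comp (WithLp.sndL 2 ℝ L2 L2Vec)).continuous
  refine (isClosed_eq (h1 0) continuous_const).and ?_
  have h3 := isClosed_iInter fun i => isClosed_iInter fun k =>
    isClosed_eq (h2 i k) (continuous_const.mul (h1 k) (f := fun _ => 2 * Real.pi * Complex.I * k i))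
  convert h3 using 1
  ext u
  simp only [Set.mem_iInter]
  rfl

instance : CompleteSpace H1dot := isClosed_H1dot.completeSpace_coe

lemma coeff_toL2_zero (u : H1dot) : coeff (toL2 u) 0 = 0 := ((mem_H1dot_iff u.1).1 u.2).1

lemma coeff_grad (u : H1dot) (i : Fin 2) (k : Fin 2 → ℤ) :
    coeff (grad u i) k = 2 * Real.pi * Complex.I * k i * coeff (toL2 u) k :=
  ((mem_H1dot_iff u.1).1 u.2).2 i k

lemma isWeakDeriv_grad (u : H1dot) (i : Fin 2) : IsWeakDeriv i (toL2 u) (grad u i) := u.2.2 i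

/-- The pair `(u, g)` as an element of `Ḣ¹`, when `g` is the gradient of `u` in Fourier space. -/
def mkH1 (u : L2) (g : Fin 2 → L2) (h0 : coeff u 0 = 0)
    (h : ∀ i k, coeff (g i) k = 2 * Real.pi * Complex.I * k i * coeff u k) : H1dot :=
  ⟨WithLp.toLp 2 (u, WithLp.toLp 2 g), (mem_H1dot_iff _).2 ⟨h0, h⟩⟩

lemma toL2_injective : Function.Injective toL2 := by
  intro u w h
  refine Subtype.ext (WithLp.ofLp_injective 2 (Prod.ext h ?_))
  refine PiLp.ext fun i => ext_coeff fun k => ?_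
  exact (coeff_grad u i k).trans
    ((congrArg (fun f => 2 * Real.pi * Complex.I * k i * coeff f k) h).trans
      (coeff_grad w i k).symm)

lemma inner_H1dot (u w : H1dot) :
    inner ℝ u w = inner ℝ (toL2 u) (toL2 w) + inner ℝ (grad u) (grad w) := rfl

lemma norm_sq_H1dot (u : H1dot) : ‖u‖ ^ 2 = ‖toL2 u‖ ^ 2 + ∑ i, ‖grad u i‖ ^ 2 := by
  rw [← real_inner_self_eq_norm_sq, inner_H1dot, real_inner_self_eq_norm_sq,
    real_inner_self_eq_norm_sq, PiLp.norm_sq_eq_of_L2]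

lemma norm_H1dot_le {u w : H1dot} {C : ℝ} (hC : 0 ≤ C) (h : ‖toL2 u‖ ≤ C * ‖toL2 w‖)
    (hg : ∀ i, ‖grad u i‖ ≤ C * ‖grad w i‖) : ‖u‖ ≤ C * ‖w‖ := by
  refine le_of_sq_le_sq ?_ (by positivity)
  rw [mul_pow, norm_sq_H1dot, norm_sq_H1dot, mul_add, Finset.mul_sum]
  refine add_le_add ?_ (Finset.sum_le_sum fun i _ => ?_)
  · rw [← mul_pow]
    exact pow_le_pow_left₀ (norm_nonneg _) h 2
  · rw [← mul_pow]
    exact pow_le_pow_left₀ (norm_nonneg _) (hg i) 2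

/-- A Fourier multiplier with bounded symbol, as a linear operator on `Ḣ¹`. -/
def fourierMulH1Lin (m : lp (fun _ : Fin 2 → ℤ => ℂ) ∞) (hm : ∀ k, m (-k) = conj (m k)) :
    H1dot →ₗ[ℝ] H1dot where
  toFun u := mkH1 (fourierMul m (toL2 u)) (fun i => fourierMul m (grad u i))
    (by rw [coeff_fourierMul hm, coeff_toL2_zero, mul_zero])
    (fun i k => by rw [coeff_fourierMul hm, coeff_fourierMul hm, coeff_grad]; ring)
  map_add' u w := toL2_injective <| ((fourierMul m).comp toL2).map_add u w
  map_smul' c u := toL2_injective <| ((fourierMul m).comp toL2).map_smul c u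

/-- A Fourier multiplier with bounded symbol, as a bounded operator on `Ḣ¹`. -/
def fourierMulH1 (m : lp (fun _ : Fin 2 → ℤ => ℂ) ∞) (hm : ∀ k, m (-k) = conj (m k)) :
    H1dot →L[ℝ] H1dot :=
  (fourierMulH1Lin m hm).mkContinuous ‖fourierMul m‖ fun u =>
    norm_H1dot_le (norm_nonneg _) ((fourierMul m).le_opNorm (toL2 u))
      fun i => (fourierMul m).le_opNorm (grad u i)

/-- A smooth function of mean zero as an element of `Ḣ¹`. -/
def ofSmooth (f : Torus → ℝ) (hf : IsSmooth f) (h0 : ∫ x, f x ∂μ = 0) : H1dot :=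
  mkH1 (ofCont f hf.continuous) (fun i => ofCont _ (hf.continuous_partialDeriv i))
    (by
      rw [← integral_eq_zero_iff, ← h0]
      exact integral_congr_ae (coeFn_ofCont hf.continuous))
    (fun i k => coeff_partialDeriv hf i k)

lemma coeFn_toL2_ofSmooth {f : Torus → ℝ} (hf : IsSmooth f) (h0 : ∫ x, f x ∂μ = 0) :
    toL2 (ofSmooth f hf h0) =ᵐ[μ] f := coeFn_ofCont hf.continuous

lemma coeFn_grad_ofSmooth {f : Torus → ℝ} (hf : IsSmooth f) (h0 : ∫ x, f x ∂μ = 0) (i : Fin 2) :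
    grad (ofSmooth f hf h0) i =ᵐ[μ] partialDeriv i f := coeFn_ofCont (hf.continuous_partialDeriv i)

lemma IsSmooth.add {f g : Torus → ℝ} (hf : IsSmooth f) (hg : IsSmooth g) :
    IsSmooth fun x => f x + g x := ContDiff.add hf hg

lemma IsSmooth.mul {f g : Torus → ℝ} (hf : IsSmooth f) (hg : IsSmooth g) :
    IsSmooth fun x => f x * g x := ContDiff.mul hf hg

lemma IsSmooth.const_mul {f : Torus → ℝ} (c : ℝ) (hf : IsSmooth f) :
    IsSmooth fun x => c * f x := ContDiff.mul contDiff_const hf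

/-- The elements of `Ḣ¹` which have a smooth representative. -/
def smoothH1 : Set H1dot := {u | ∃ f, IsSmooth f ∧ toL2 u =ᵐ[μ] f}

lemma zero_mem_smoothH1 : 0 ∈ smoothH1 := ⟨fun _ => 0, contDiff_const, by
  rw [map_zero]
  exact Lp.coeFn_zero _ _ _⟩

lemma add_mem_smoothH1 {u w : H1dot} (hu : u ∈ smoothH1) (hw : w ∈ smoothH1) :
    u + w ∈ smoothH1 := by
  obtain ⟨f, hf, hfu⟩ := hu
  obtain ⟨g, hg, hgw⟩ := hw
  refine ⟨_, hf.add hg, ?_⟩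
  rw [map_add]
  filter_upwards [Lp.coeFn_add (toL2 u) (toL2 w), hfu, hgw] with x h1 h2 h3
  rw [h1, Pi.add_apply, h2, h3]

lemma smul_mem_smoothH1 (c : ℝ) {u : H1dot} (hu : u ∈ smoothH1) : c • u ∈ smoothH1 := by
  obtain ⟨f, hf, hfu⟩ := hu
  refine ⟨_, hf.const_mul c, ?_⟩
  rw [map_smul]
  filter_upwards [Lp.coeFn_smul c (toL2 u), hfu] with x h1 h2
  rw [h1, Pi.smul_apply, h2, smul_eq_mul]

lemma exists_ofSmooth_of_mem {u : H1dot} (hu : u ∈ smoothH1) :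
    ∃ (f : Torus → ℝ) (hf : IsSmooth f) (h0 : ∫ x, f x ∂μ = 0), u = ofSmooth f hf h0 := by
  obtain ⟨f, hf, hfu⟩ := hu
  have h0 : ∫ x, f x ∂μ = 0 := by rw [← integral_congr_ae hfu]; exact u.2.1
  exact ⟨f, hf, h0, toL2_injective (Lp.ext (hfu.trans (coeFn_toL2_ofSmooth hf h0).symm))⟩

lemma ofSmooth_mem {f : Torus → ℝ} (hf : IsSmooth f) (h0 : ∫ x, f x ∂μ = 0) :
    ofSmooth f hf h0 ∈ smoothH1 := ⟨f, hf, coeFn_toL2_ofSmooth hf h0⟩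

lemma integral_wave {k : Fin 2 → ℤ} (hk : k ≠ 0) (z : ℂ) : ∫ x, wave k z x ∂μ = 0 := by
  obtain ⟨i, hi⟩ := Function.ne_iff.1 hk
  have hc : (2 * Real.pi * Complex.I * k i : ℂ) ≠ 0 := by
    have : (k i : ℂ) ≠ 0 := by exact_mod_cast hi
    simp [Real.pi_ne_zero, this]
  -- a wave is the derivative of a wave, and derivatives have mean zero
  have h := coeff_partialDeriv (isSmooth_wave k (z / (2 * Real.pi * Complex.I * k i))) i 0
  rw [Pi.zero_apply, Int.cast_zero, mul_zero, zero_mul, ← integral_eq_zero_iff] at h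
  rw [← h]
  refine integral_congr_ae ?_
  filter_upwards [coeFn_ofCont ((isSmooth_wave k
    (z / (2 * Real.pi * Complex.I * k i))).continuous_partialDeriv i)] with x hx
  rw [hx, partialDeriv_wave, div_mul_cancel₀ _ hc]

lemma inner_eq_integral (u : L2) {w : L2} {f : Torus → ℝ} (h : w =ᵐ[μ] f) :
    inner ℝ u w = ∫ x, u x * f x ∂μ := by
  rw [L2.inner_def]
  refine integral_congr_ae ?_
  filter_upwards [h] with x hx
  rw [hx]
  simp [mul_comm]

lemma dense_of_orthogonal_eq_zero {V : Type*} [NormedAddCommGroup V] [InnerProductSpace ℝ V]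
    [CompleteSpace V] {S : Set V} (h0 : 0 ∈ S) (hadd : ∀ u ∈ S, ∀ w ∈ S, u + w ∈ S)
    (hsmul : ∀ (c : ℝ), ∀ u ∈ S, c • u ∈ S)
    (h : ∀ u : V, (∀ w ∈ S, inner ℝ u w = 0) → u = 0) : Dense S := by
  let K : Submodule ℝ V :=
    { carrier := S, zero_mem' := h0, add_mem' := fun hu hw => hadd _ hu _ hw,
      smul_mem' := fun c _ hu => hsmul c _ hu }
  have hK : Dense (K : Set V) := by
    rw [Submodule.dense_iff_topologicalClosure_eq_top, Submodule.topologicalClosure_eq_top_iff,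
      Submodule.eq_bot_iff]
    exact fun u hu => h u ((Submodule.mem_orthogonal' _ _).1 hu)
  exact hK

/-- Smooth functions are dense in `Ḣ¹`: an element orthogonal to all waves has vanishing Fourier
coefficients, since waves are eigenfunctions of `1 - Δ`. -/
lemma dense_smoothH1 : Dense smoothH1 := by
  have hadd : ∀ u ∈ smoothH1, ∀ w ∈ smoothH1, u + w ∈ smoothH1 :=
    fun u hu w hw => add_mem_smoothH1 hu hw
  have hsmul : ∀ (c : ℝ), ∀ u ∈ smoothH1, c • u ∈ smoothH1 := fun c u hu => smul_mem_smoothH1 c hu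
  refine dense_of_orthogonal_eq_zero (V := H1dot) zero_mem_smoothH1 hadd hsmul fun u hu => ?_
  refine toL2_injective (ext_coeff fun k => ?_)
  rw [map_zero, coeff_zero]
  by_cases hk : k = 0
  · rw [hk]; exact coeff_toL2_zero u
  refine eq_zero_of_forall_re_mul fun z => ?_
  have hk' : -k ≠ 0 := neg_ne_zero.2 hk
  have h0 := integral_wave hk' z
  have hs := isSmooth_wave (-k) z
  have h := hu _ (ofSmooth_mem hs h0)
  rw [inner_H1dot, inner_eq_integral _ (coeFn_toL2_ofSmooth hs h0), PiLp.inner_apply] at h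
  have hi : ∀ i, inner ℝ (grad u i) (grad (ofSmooth _ hs h0) i) =
      (2 * Real.pi * k i) ^ 2 * (z * coeff (toL2 u) k).re := by
    intro i
    rw [inner_eq_integral _ (coeFn_grad_ofSmooth hs h0 i), partialDeriv_wave, integral_mul_wave,
      neg_neg, coeff_grad]
    rw [← Complex.re_ofReal_mul]
    congr 1
    generalize coeff (toL2 u) k = c
    rw [Pi.neg_apply]
    push_cast
    linear_combination (-4 * z * Real.pi ^ 2 * k i ^ 2 * c) * Complex.I_sq
  rw [Finset.sum_congr rfl fun i _ => hi i, integral_mul_wave, neg_neg, ← Finset.sum_mul,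
    ← one_add_mul] at h
  refine (mul_eq_zero.1 h).resolve_left (ne_of_gt ?_)
  positivity

/-! ### The stream function and the velocity field -/

/-- The length `|k|` of a frequency `k ∈ ℤ²`. -/
def freqNorm (k : Fin 2 → ℤ) : ℝ := √(∑ i, (k i : ℝ) ^ 2)

lemma freqNorm_sq (k : Fin 2 → ℤ) : freqNorm k ^ 2 = ∑ i, (k i : ℝ) ^ 2 :=
  Real.sq_sqrt (by positivity)

lemma freqNorm_neg (k : Fin 2 → ℤ) : freqNorm (-k) = freqNorm k := by
  simp [freqNorm]

lemma abs_le_freqNorm (k : Fin 2 → ℤ) (i : Fin 2) : |(k i : ℝ)| ≤ freqNorm k := by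
  refine Real.abs_le_sqrt ?_
  exact Finset.single_le_sum (f := fun i => (k i : ℝ) ^ 2) (fun j _ => sq_nonneg _)
    (Finset.mem_univ i)

lemma one_le_freqNorm {k : Fin 2 → ℤ} (hk : k ≠ 0) : 1 ≤ freqNorm k := by
  obtain ⟨i, hi⟩ := Function.ne_iff.1 hk
  refine le_trans ?_ (abs_le_freqNorm k i)
  exact_mod_cast Int.one_le_abs hi

lemma freqNorm_pos {k : Fin 2 → ℤ} (hk : k ≠ 0) : 0 < freqNorm k :=
  one_pos.trans_le (one_le_freqNorm hk)

lemma freqNorm_zero : freqNorm 0 = 0 := by simp [freqNorm]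

/-- A symbol bounded by one. -/
def symbol (m : (Fin 2 → ℤ) → ℂ) (hm : ∀ k, ‖m k‖ ≤ 1) : lp (fun _ : Fin 2 → ℤ => ℂ) ∞ :=
  ⟨m, memℓp_infty ⟨1, by rintro _ ⟨k, rfl⟩; exact hm k⟩⟩

/-- The symbol `1 / |2πk|` of `(-Δ)^{-1/2}`; its value at `k = 0` is `0⁻¹ = 0`. -/
def streamSymbol : lp (fun _ : Fin 2 → ℤ => ℂ) ∞ :=
  symbol (fun k => (((2 * Real.pi * freqNorm k)⁻¹ : ℝ) : ℂ)) fun k => by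
    rw [Complex.norm_real, Real.norm_of_nonneg (by unfold freqNorm; positivity)]
    by_cases hk : k = 0
    · simp [hk, freqNorm_zero]
    · refine inv_le_one_of_one_le₀ ?_
      nlinarith [Real.pi_gt_three, one_le_freqNorm hk]

/-- The symbol `i kⱼ / |k|` of the Riesz transform `∂ⱼ (-Δ)^{-1/2}`. -/
def rieszSymbol (j : Fin 2) : lp (fun _ : Fin 2 → ℤ => ℂ) ∞ :=
  symbol (fun k => Complex.I * ((k j / freqNorm k : ℝ) : ℂ)) fun k => by
    rw [norm_mul, Complex.norm_I, one_mul, Complex.norm_real, Real.norm_eq_abs, abs_div]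
    refine div_le_one_of_le₀ ((abs_le_freqNorm k j).trans (le_abs_self _)) (abs_nonneg _)

lemma streamSymbol_apply (k : Fin 2 → ℤ) :
    streamSymbol k = (((2 * Real.pi * freqNorm k)⁻¹ : ℝ) : ℂ) := rfl

lemma rieszSymbol_apply (j : Fin 2) (k : Fin 2 → ℤ) :
    rieszSymbol j k = Complex.I * ((k j / freqNorm k : ℝ) : ℂ) := rfl

lemma streamSymbol_neg (k : Fin 2 → ℤ) : streamSymbol (-k) = conj (streamSymbol k) := by
  rw [streamSymbol_apply, streamSymbol_apply, freqNorm_neg]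
  exact (Complex.conj_ofReal _).symm

lemma rieszSymbol_neg (j : Fin 2) (k : Fin 2 → ℤ) :
    rieszSymbol j (-k) = conj (rieszSymbol j k) := by
  rw [rieszSymbol_apply, rieszSymbol_apply, freqNorm_neg]
  refine Eq.trans ?_ (map_mul (starRingEnd ℂ) _ _).symm
  rw [Complex.conj_I, Complex.conj_ofReal]
  push_cast [Pi.neg_apply]
  ring

/-- The stream function `ψ = (-Δ)^{-1/2} θ`. -/
def stream : H1dot →L[ℝ] H1dot := fourierMulH1 streamSymbol streamSymbol_neg

/-- The Riesz transform `∂ⱼ (-Δ)^{-1/2}`. -/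
def riesz (j : Fin 2) : H1dot →L[ℝ] H1dot := fourierMulH1 (rieszSymbol j) (rieszSymbol_neg j)

lemma coeff_stream (u : H1dot) (k : Fin 2 → ℤ) :
    coeff (toL2 (stream u)) k = (((2 * Real.pi * freqNorm k)⁻¹ : ℝ) : ℂ) * coeff (toL2 u) k :=
  coeff_fourierMul streamSymbol_neg _ _

lemma coeff_riesz (j : Fin 2) (u : H1dot) (k : Fin 2 → ℤ) :
    coeff (toL2 (riesz j u)) k = Complex.I * ((k j / freqNorm k : ℝ) : ℂ) * coeff (toL2 u) k :=
  coeff_fourierMul (rieszSymbol_neg j) _ _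

lemma grad_stream (u : H1dot) (j : Fin 2) : grad (stream u) j = toL2 (riesz j u) := by
  refine ext_coeff fun k => ?_
  rw [coeff_grad, coeff_stream, coeff_riesz]
  have hpi : (Real.pi : ℂ) ≠ 0 := by exact_mod_cast Real.pi_ne_zero
  push_cast
  rw [mul_inv, mul_inv]
  field_simp

/-- The equation `(-Δ)^{1/2} ψ = u` in `Ḣ¹` has the unique solution `stream u`. -/
lemma isHalfLaplacian_iff (ψ u : H1dot) : IsHalfLaplacian (toL2 ψ) (toL2 u) ↔ ψ = stream u := by
  have h : IsHalfLaplacian (toL2 ψ) (toL2 u) ↔ ∀ k,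
      ((2 * Real.pi * freqNorm k : ℝ) : ℂ) * coeff (toL2 ψ) k = coeff (toL2 u) k := by
    simp only [coeff_eq_mFourierCoeff]
    rfl
  rw [h]
  constructor
  · intro h
    refine toL2_injective (ext_coeff fun k => ?_)
    by_cases hk : k = 0
    · rw [hk, coeff_toL2_zero, coeff_toL2_zero]
    · rw [coeff_stream, ← h k, ← mul_assoc, ← Complex.ofReal_mul, inv_mul_cancel₀,
        Complex.ofReal_one, one_mul]
      have := freqNorm_pos hk
      positivity
  · rintro rfl k
    by_cases hk : k = 0
    · rw [hk, coeff_toL2_zero, coeff_toL2_zero, mul_zero]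
    · rw [coeff_stream, ← mul_assoc, ← Complex.ofReal_mul, mul_inv_cancel₀,
        Complex.ofReal_one, one_mul]
      have := freqNorm_pos hk
      positivity

/-- The components of the velocity `∇^⊥ (-Δ)^{-1/2} u`, which again belong to `Ḣ¹`. -/
def velocity (i : Fin 2) : H1dot →L[ℝ] H1dot := ![-riesz 1, riesz 0] i

lemma perpGrad_stream (u : H1dot) (i : Fin 2) : perpGrad (stream u) i = toL2 (velocity i u) := by
  fin_cases i
  · change -(grad (stream u) 1) = toL2 (-(riesz 1 u))
    rw [grad_stream, map_neg]
  · exact grad_stream u 0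

/-- The velocity is divergence free. -/
lemma div_velocity (u : H1dot) : grad (velocity 0 u) 0 + grad (velocity 1 u) 1 = 0 := by
  have h : grad (riesz 1 u) 0 = grad (riesz 0 u) 1 := by
    refine ext_coeff fun k => ?_
    rw [coeff_grad, coeff_grad, coeff_riesz, coeff_riesz]
    push_cast
    ring
  have h0 : grad (velocity 0 u) 0 = -(grad (riesz 1 u) 0) := by
    change grad (-(riesz 1 u)) 0 = _
    rw [map_neg]
    rfl
  rw [h0, h]
  exact neg_add_cancel _

/-! ### The embedding of `Ḣ¹` into `L⁴` -/

/-- The Cauchy-Schwarz inequality for series in `[0, ∞]`. -/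
lemma ennreal_tsum_mul_sq_le {ι : Type*} (f g : ι → ℝ≥0∞) :
    (∑' i, f i * g i) ^ 2 ≤ (∑' i, f i ^ 2) * ∑' i, g i ^ 2 := by
  let _ : MeasurableSpace ι := ⊤
  have h := ENNReal.lintegral_mul_le_Lp_mul_Lq (Measure.count : Measure ι)
    Real.HolderConjugate.two_two (f := f) (g := g) (measurable_from_top).aemeasurable
    (measurable_from_top).aemeasurable
  simp only [lintegral_count, Pi.mul_apply, ENNReal.rpow_two] at h
  calc (∑' i, f i * g i) ^ 2
      ≤ ((∑' i, f i ^ 2) ^ (1 / 2 : ℝ) * (∑' i, g i ^ 2) ^ (1 / 2 : ℝ)) ^ 2 := by gcongr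
    _ = (∑' i, f i ^ 2) * ∑' i, g i ^ 2 := by
        rw [mul_pow, ← ENNReal.rpow_mul_natCast, ← ENNReal.rpow_mul_natCast]
        norm_num

lemma tsum_enorm_coeff_sq (u : L2) : ∑' k, ‖coeff u k‖ₑ ^ 2 = ‖u‖ₑ ^ 2 := by
  have h := hasSum_coeff u u
  have h1 : HasSum (fun k => ‖coeff u k‖ ^ 2) (‖u‖ ^ 2) := by
    have e : ∫ x, u x * u x ∂μ = ‖u‖ ^ 2 := by
      rw [← real_inner_self_eq_norm_sq, inner_eq_integral u (Filter.EventuallyEq.refl _ _)]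
    rw [e] at h
    refine Complex.hasSum_ofReal.1 (h.congr_fun fun k => ?_)
    rw [Complex.conj_mul']
    push_cast
    rfl
  have h2 := ENNReal.ofReal_tsum_of_nonneg (fun k => sq_nonneg ‖coeff u k‖) h1.summable
  rw [h1.tsum_eq, ENNReal.ofReal_pow (norm_nonneg _), ofReal_norm] at h2
  rw [h2]
  simp only [ENNReal.ofReal_pow (norm_nonneg _), ofReal_norm]

/-- The weight `1 + 4π²|k|²`, the symbol of `1 - Δ`. -/
def weight (k : Fin 2 → ℤ) : ℝ≥0∞ := ENNReal.ofReal (1 + (2 * Real.pi * freqNorm k) ^ 2)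

lemma weight_ne_zero (k : Fin 2 → ℤ) : weight k ≠ 0 := by
  rw [weight, ne_eq, ENNReal.ofReal_eq_zero, not_le]
  positivity

lemma weight_ne_top (k : Fin 2 → ℤ) : weight k ≠ ⊤ := ENNReal.ofReal_ne_top

/-- The norm of `Ḣ¹` in Fourier space. -/
lemma tsum_weight_mul_enorm_coeff_sq (u : H1dot) :
    ∑' k, weight k * ‖coeff (toL2 u) k‖ₑ ^ 2 = ‖u‖ₑ ^ 2 := by
  have h : ∀ k, weight k * ‖coeff (toL2 u) k‖ₑ ^ 2 =
      ‖coeff (toL2 u) k‖ₑ ^ 2 + ∑ i, ‖coeff (grad u i) k‖ₑ ^ 2 := by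
    intro k
    simp only [coeff_grad, ← ofReal_norm, ← ENNReal.ofReal_pow (norm_nonneg _), weight]
    rw [← ENNReal.ofReal_sum_of_nonneg (fun i _ => by positivity),
      ← ENNReal.ofReal_mul (by positivity), ← ENNReal.ofReal_add (by positivity) (by positivity)]
    congr 1
    simp only [norm_mul, Complex.norm_real, Complex.norm_I, Complex.norm_ofNat,
      Complex.norm_intCast, mul_pow, freqNorm_sq, Real.norm_eq_abs, sq_abs, Fin.sum_univ_two]
    ring
  simp only [h]
  rw [ENNReal.tsum_add, tsum_enorm_coeff_sq]
  simp only [Fin.sum_univ_two]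
  rw [ENNReal.tsum_add, tsum_enorm_coeff_sq, tsum_enorm_coeff_sq]
  simp only [← ofReal_norm, ← ENNReal.ofReal_pow (norm_nonneg _)]
  rw [norm_sq_H1dot, Fin.sum_univ_two, ENNReal.ofReal_add (by positivity) (by positivity),
    ENNReal.ofReal_add (by positivity) (by positivity)]

/-- The sum `∑ (1 + 4π²|k|²)⁻²` over `ℤ²`, finite because `4 > 2`. -/
def weightSum : ℝ≥0∞ := ∑' k, (weight k)⁻¹ ^ 2

lemma weightSum_ne_top : weightSum ≠ ⊤ := by
  have hs : Summable fun k : Fin 2 → ℤ => ‖k‖ ^ (-4 : ℝ) + Pi.single (M := fun _ => ℝ) 0 1 k :=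
    (EisensteinSeries.summable_one_div_norm_rpow (by norm_num)).add
      (hasSum_pi_single 0 (1 : ℝ)).summable
  refine ne_top_of_le_ne_top hs.tsum_ofReal_ne_top (ENNReal.tsum_le_tsum fun k => ?_)
  rw [weight, ← ENNReal.ofReal_inv_of_pos (by positivity), ← ENNReal.ofReal_pow (by positivity)]
  refine ENNReal.ofReal_le_ofReal ?_
  by_cases hk : k = 0
  · simp [hk, freqNorm_zero]
  · have hn : 0 < ‖k‖ := norm_pos_iff.2 hk
    have hle : ‖k‖ ≤ freqNorm k := by
      refine (pi_norm_le_iff_of_nonneg (Real.sqrt_nonneg _)).2 fun i => ?_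
      rw [Int.norm_eq_abs]
      exact abs_le_freqNorm k i
    rw [Pi.single_eq_of_ne hk, add_zero, Real.rpow_neg hn.le, inv_pow]
    refine inv_anti₀ (by positivity) ?_
    have h1 : ‖k‖ ^ 2 ≤ 1 + (2 * Real.pi * freqNorm k) ^ 2 := by
      have : ‖k‖ ^ 2 ≤ freqNorm k ^ 2 := by gcongr
      have hpi : 1 ≤ (2 * Real.pi) ^ 2 := by nlinarith [Real.pi_gt_three]
      rw [mul_pow]
      nlinarith [sq_nonneg (freqNorm k)]
    calc ‖k‖ ^ (4 : ℝ) = (‖k‖ ^ 2) ^ 2 := by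
          rw [← pow_mul]
          exact_mod_cast Real.rpow_natCast ‖k‖ 4
      _ ≤ _ := by gcongr

/-- A weighted Young inequality for convolutions: since `∑ⱼ (w(j) w(k-j))⁻¹` is bounded in `k`,
a sequence with `∑ w |a|² < ∞` has a convolution square in `ℓ²`. -/
lemma tsum_convolution_sq_le (a : (Fin 2 → ℤ) → ℝ≥0∞) :
    ∑' k, (∑' j, a j * a (k - j)) ^ 2 ≤ 2 * weightSum * (∑' k, weight k * a k ^ 2) ^ 2 := by
  have hw : ∀ k, ∑' j, (weight j)⁻¹ * (weight (k - j))⁻¹ ≤ 2 * weightSum := by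
    intro k
    have h : ∀ x y : ℝ≥0∞, x * y ≤ x ^ 2 + y ^ 2 := by
      intro x y
      rcases le_total x y with hxy | hxy
      · calc x * y ≤ y * y := by gcongr
          _ ≤ _ := by rw [sq y]; exact le_add_self
      · calc x * y ≤ x * x := by gcongr
          _ ≤ _ := by rw [sq x]; exact le_self_add
    refine (ENNReal.tsum_le_tsum fun j => h _ _).trans ?_
    rw [ENNReal.tsum_add, two_mul]
    exact add_le_add le_rfl (le_of_eq ((Equiv.subLeft k).tsum_eq (fun j => (weight j)⁻¹ ^ 2)))
  have hsq : ∀ x : ℝ≥0∞, ((x ^ (1 / 2 : ℝ)) ^ 2) = x := fun x => by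
    rw [← ENNReal.rpow_mul_natCast]; norm_num
  have key : ∀ k, (∑' j, a j * a (k - j)) ^ 2 ≤
      2 * weightSum * ∑' j, (weight j * a j ^ 2) * (weight (k - j) * a (k - j) ^ 2) := by
    intro k
    have hj : ∀ j, a j * a (k - j) =
        ((weight j)⁻¹ * (weight (k - j))⁻¹) ^ (1 / 2 : ℝ) *
          ((weight j * weight (k - j)) ^ (1 / 2 : ℝ) * (a j * a (k - j))) := by
      intro j
      rw [← mul_assoc, ← ENNReal.mul_rpow_of_nonneg _ _ (by norm_num)]
      have : (weight j)⁻¹ * (weight (k - j))⁻¹ * (weight j * weight (k - j)) = 1 := by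
        calc _ = ((weight j)⁻¹ * weight j) * ((weight (k - j))⁻¹ * weight (k - j)) := by ring
          _ = 1 := by
            rw [ENNReal.inv_mul_cancel (weight_ne_zero _) (weight_ne_top _),
              ENNReal.inv_mul_cancel (weight_ne_zero _) (weight_ne_top _), one_mul]
      rw [this, ENNReal.one_rpow, one_mul]
    rw [tsum_congr hj]
    refine (ennreal_tsum_mul_sq_le _ _).trans ?_
    gcongr
    · refine le_trans (le_of_eq (tsum_congr fun j => ?_)) (hw k)
      exact hsq _
    · refine le_of_eq ?_
      rw [mul_pow, hsq]
      ring
  refine (ENNReal.tsum_le_tsum key).trans (le_of_eq ?_)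
  rw [ENNReal.tsum_mul_left, ENNReal.tsum_comm]
  congr 1
  simp only [ENNReal.tsum_mul_left]
  have : ∀ j, ∑' k, weight (k - j) * a (k - j) ^ 2 = ∑' k, weight k * a k ^ 2 := fun j =>
    (Equiv.subRight j).tsum_eq (fun k => weight k * a k ^ 2)
  simp only [this, ENNReal.tsum_mul_right]
  rw [sq]

/-- The Fourier coefficients of a square are a convolution. -/
lemma hasSum_coeff_sq {f : Torus → ℝ} (hf : Continuous f) (k : Fin 2 → ℤ) :
    HasSum (fun j => coeff (ofCont f hf) j * coeff (ofCont f hf) (k - j))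
      (coeff (ofCont (fun x => f x * f x) (hf.mul hf)) k) := by
  set e : C(Torus, ℂ) := ⟨fun x => mFourier k x * (f x : ℂ), by fun_prop⟩ with he
  set g : C(Torus, ℂ) := ⟨fun x => (f x : ℂ), by fun_prop⟩ with hg
  have h1 := lp.hasSum_inner (𝕜 := ℂ) (G := fun _ : Fin 2 → ℤ => ℂ)
    (fourierEquiv (ContinuousMap.toLp 2 μ ℂ e))
    (fourierEquiv (ContinuousMap.toLp 2 μ ℂ g))
  have h2 : inner ℂ (fourierEquiv (ContinuousMap.toLp 2 μ ℂ e))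
      (fourierEquiv (ContinuousMap.toLp 2 μ ℂ g)) =
      coeff (ofCont (fun x => f x * f x) (hf.mul hf)) k := by
    rw [LinearIsometryEquiv.inner_map_map, L2.inner_def, coeff_ofCont]
    refine integral_congr_ae ?_
    filter_upwards [ContinuousMap.coeFn_toLp μ (𝕜 := ℂ) (p := 2) e,
      ContinuousMap.coeFn_toLp μ (𝕜 := ℂ) (p := 2) g] with x hx hx'
    rw [hx, hx', he, hg]
    simp [mFourier_neg]
    ring
  have h3 : ∀ j, fourierEquiv (ContinuousMap.toLp 2 μ ℂ e) j =
      conj (coeff (ofCont f hf) (k - j)) := by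
    intro j
    rw [fourierEquiv_apply, coeff_ofCont, ← integral_conj]
    refine integral_congr_ae ?_
    filter_upwards [ContinuousMap.coeFn_toLp μ (𝕜 := ℂ) (p := 2) e] with x hx
    rw [hx, map_mul, Complex.conj_ofReal, ← mFourier_neg, neg_neg, sub_eq_neg_add, mFourier_add, he]
    simp [mul_assoc]
  have h4 : ∀ j, fourierEquiv (ContinuousMap.toLp 2 μ ℂ g) j = coeff (ofCont f hf) j := by
    intro j
    rw [fourierEquiv_apply, coeff_ofCont]
    refine integral_congr_ae ?_
    filter_upwards [ContinuousMap.coeFn_toLp μ (𝕜 := ℂ) (p := 2) g] with x hx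
    rw [hx, hg]
    rfl
  rw [h2] at h1
  refine h1.congr_fun fun j => ?_
  rw [h3, h4]
  simp

instance : Fact ((1 : ℝ≥0∞) ≤ 4) := ⟨by norm_num⟩

instance : ENNReal.HolderTriple 4 4 2 := ⟨by
  rw [← two_mul, show (4 : ℝ≥0∞) = 2 * 2 by norm_num,
    ENNReal.mul_inv (Or.inl two_ne_zero) (Or.inl ENNReal.ofNat_ne_top), ← mul_assoc,
    ENNReal.mul_inv_cancel two_ne_zero ENNReal.ofNat_ne_top, one_mul]⟩

/-- A constant for the embedding of `Ḣ¹` into `L⁴`. It is chosen to be at least one, so that its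
fourth power is at least `2 * weightSum`. -/
def embeddingConst : ℝ≥0∞ := 2 * weightSum + 1

lemma embeddingConst_ne_top : embeddingConst ≠ ⊤ :=
  ENNReal.add_ne_top.2
    ⟨ENNReal.mul_ne_top ENNReal.ofNat_ne_top weightSum_ne_top, ENNReal.one_ne_top⟩

/-- For smooth `u` one has `‖u‖₄⁴ = ‖u²‖₂²`, and the Fourier coefficients of `u²` are a
convolution square. -/
lemma eLpNorm_four_le_of_mem {u : H1dot} (hu : u ∈ smoothH1) :
    eLpNorm (toL2 u) 4 μ ≤ embeddingConst * ‖u‖ₑ := by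
  obtain ⟨f, hf, hfu⟩ := hu
  have hc := hf.continuous
  have hfL : ofCont f hc = toL2 u := Lp.ext ((coeFn_ofCont hc).trans hfu.symm)
  set q := ofCont (fun x => f x * f x) (hc.mul hc) with hq
  have h1 : ‖q‖ₑ ^ 2 ≤ 2 * weightSum * (‖u‖ₑ ^ 2) ^ 2 := by
    rw [← tsum_enorm_coeff_sq, ← tsum_weight_mul_enorm_coeff_sq]
    refine le_trans (ENNReal.tsum_le_tsum fun k => ?_)
      (tsum_convolution_sq_le fun k => ‖coeff (toL2 u) k‖ₑ)
    have h := hasSum_coeff_sq hc k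
    rw [hfL] at h
    rw [← h.tsum_eq]
    refine pow_le_pow_left' (enorm_tsum_le_tsum_enorm.trans_eq ?_) 2
    simp only [enorm_mul]
  have h2 : ‖q‖ₑ = eLpNorm (toL2 u) 4 μ ^ 2 := by
    have h := eLpNorm_norm_rpow (μ := μ) (p := 2) f (q := 2) two_pos
    have hqf : q =ᵐ[μ] fun x => f x * f x := coeFn_ofCont (hc.mul hc)
    rw [Lp.enorm_def, eLpNorm_congr_ae hqf, eLpNorm_congr_ae hfu]
    have e : (fun x => ‖f x‖ ^ (2 : ℝ)) = fun x => f x * f x := by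
      funext x
      rw [Real.rpow_two, Real.norm_eq_abs, sq_abs, sq]
    have e4 : (2 : ℝ≥0∞) * ENNReal.ofReal 2 = 4 := by
      rw [ENNReal.ofReal_ofNat]; norm_num
    rw [e, e4, ENNReal.rpow_two] at h
    exact h
  have h3 : eLpNorm (toL2 u) 4 μ ^ 4 ≤ (embeddingConst * ‖u‖ₑ) ^ 4 := by
    calc eLpNorm (toL2 u) 4 μ ^ 4 = ‖q‖ₑ ^ 2 := by rw [h2, ← pow_mul]
      _ ≤ 2 * weightSum * (‖u‖ₑ ^ 2) ^ 2 := h1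
      _ ≤ embeddingConst ^ 4 * ‖u‖ₑ ^ 4 := by
        rw [← pow_mul]
        gcongr
        calc 2 * weightSum ≤ embeddingConst := le_self_add
          _ ≤ embeddingConst ^ 4 := le_self_pow₀ le_add_self (by norm_num)
      _ = _ := (mul_pow _ _ _).symm
  exact (ENNReal.pow_le_pow_left_iff (by norm_num)).1 h3

/-- The estimate passes to the closure by Fatou's lemma. -/
lemma eLpNorm_four_le (u : H1dot) : eLpNorm (toL2 u) 4 μ ≤ embeddingConst * ‖u‖ₑ := by
  refine le_of_forall_gt_imp_ge_of_dense fun D hD => ?_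
  obtain ⟨v, hv, hvu⟩ := mem_closure_iff_seq_limit.1 (dense_smoothH1 u)
  have hL2 : Filter.Tendsto (fun n => toL2 (v n)) Filter.atTop (nhds (toL2 u)) :=
    (toL2.continuous.tendsto u).comp hvu
  obtain ⟨ns, hns, hae⟩ := (tendstoInMeasure_of_tendsto_Lp hL2).exists_seq_tendsto_ae
  refine Lp.eLpNorm_le_of_ae_tendsto ?_ (fun n => Lp.aestronglyMeasurable (toL2 (v (ns n)))) hae
  have hlim : Filter.Tendsto (fun n => embeddingConst * ‖v (ns n)‖ₑ) Filter.atTop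
      (nhds (embeddingConst * ‖u‖ₑ)) :=
    ENNReal.Tendsto.const_mul ((hvu.comp hns.tendsto_atTop).enorm) (Or.inr embeddingConst_ne_top)
  filter_upwards [hlim.eventually (gt_mem_nhds hD)] with n hn
  exact (eLpNorm_four_le_of_mem (hv _)).trans hn.le

lemma memLp_four (u : H1dot) : MemLp (toL2 u) 4 μ :=
  ⟨Lp.aestronglyMeasurable _, (eLpNorm_four_le u).trans_lt
    (ENNReal.mul_lt_top embeddingConst_ne_top.lt_top enorm_lt_top)⟩

/-- The embedding of `Ḣ¹` into `L⁴` as a linear map. -/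
def toL4Lin : H1dot →ₗ[ℝ] Lp ℝ 4 μ where
  toFun u := (memLp_four u).toLp
  map_add' u w := by
    rw [← MemLp.toLp_add]
    refine MemLp.toLp_congr _ _ ?_
    rw [map_add]
    exact Lp.coeFn_add _ _
  map_smul' c u := by
    rw [RingHom.id_apply, ← MemLp.toLp_const_smul]
    refine MemLp.toLp_congr _ _ ?_
    rw [map_smul]
    exact Lp.coeFn_smul _ _

/-- The embedding of `Ḣ¹` into `L⁴`. -/
def toL4 : H1dot →L[ℝ] Lp ℝ 4 μ :=
  toL4Lin.mkContinuous embeddingConst.toReal fun u => by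
    have h : ‖toL4Lin u‖ = (eLpNorm (toL2 u) 4 μ).toReal := Lp.norm_toLp _ (memLp_four u)
    rw [h, ← toReal_enorm u, ← ENNReal.toReal_mul]
    exact ENNReal.toReal_mono (ENNReal.mul_ne_top embeddingConst_ne_top enorm_ne_top)
      (eLpNorm_four_le u)

lemma coeFn_toL4 (u : H1dot) : toL4 u =ᵐ[μ] toL2 u := (memLp_four u).coeFn_toLp

/-! ### The nonlinearity -/

/-- The product `Ḣ¹ × Ḣ¹ → L²`. -/
def prod : H1dot →L[ℝ] H1dot →L[ℝ] L2 :=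
  ((ContinuousLinearMap.mul ℝ ℝ).holderL μ 4 4 2).bilinearComp toL4 toL4

lemma coeFn_prod (u w : H1dot) : prod u w =ᵐ[μ] fun x => toL2 u x * toL2 w x := by
  have h : prod u w =ᵐ[μ] fun x => toL4 u x * toL4 w x :=
    (ContinuousLinearMap.mul ℝ ℝ).coeFn_holder (r := 2) (toL4 u) (toL4 w)
  filter_upwards [h, coeFn_toL4 u, coeFn_toL4 w] with x h1 h2 h3
  rw [h1, h2, h3]

/-- The `i`-th component of the gradient. -/
def gradComp (i : Fin 2) : H1dot →L[ℝ] L2 :=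
  (PiLp.proj 2 (fun _ : Fin 2 => L2) i (𝕜 := ℝ)).comp grad

/-- The functional `φ ↦ ∫ q ∂ᵢφ`, that is `-∂ᵢ q` in `Ḣ⁻¹`. -/
def pairing (i : Fin 2) : L2 →L[ℝ] Hm1dot :=
  (innerSL ℝ : L2 →L[ℝ] L2 →L[ℝ] ℝ).bilinearComp (ContinuousLinearMap.id ℝ L2) (gradComp i)

/-- The bilinear map `(u, w) ↦ -div (u v)` with `v = ∇^⊥ (-Δ)^{-1/2} w`. -/
def flux : H1dot →L[ℝ] H1dot →L[ℝ] Hm1dot :=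
  ∑ i, (ContinuousLinearMap.compL ℝ H1dot L2 Hm1dot (pairing i)).comp
    (prod.bilinearComp (ContinuousLinearMap.id ℝ H1dot) (velocity i))

lemma flux_apply (u w φ : H1dot) :
    flux u w φ = ∑ i, inner ℝ (prod u (velocity i w)) (grad φ i) := by
  simp only [flux, sum_apply]
  rfl

lemma inner_prod (u w : H1dot) (g : L2) :
    Integrable (fun x => toL2 u x * (toL2 w x * g x)) μ ∧
      inner ℝ (prod u w) g = ∫ x, toL2 u x * (toL2 w x * g x) ∂μ := by
  have h : (fun x => inner ℝ (prod u w x) (g x)) =ᵐ[μ] fun x => toL2 u x * (toL2 w x * g x) := by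
    filter_upwards [coeFn_prod u w] with x hx
    rw [hx]
    simp
    ring
  refine ⟨(L2.integrable_inner (𝕜 := ℝ) (prod u w) g).congr h, ?_⟩
  rw [L2.inner_def]
  exact integral_congr_ae h

/-- The divergence of the flux `u v` exists in `Ḣ⁻¹` and is `-flux u u`. -/
lemma isDiv_iff (u : H1dot) (F : Hm1dot) :
    IsDiv (toL2 u) (perpGrad (stream u)) F ↔ F = -flux u u := by
  have hint : ∀ φ : H1dot, ∀ i, Integrable (fun x => toL2 u x *
      (perpGrad (stream u) i x * grad φ i x)) μ := by
    intro φ i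
    rw [perpGrad_stream]
    exact (inner_prod _ _ _).1
  have hval : ∀ φ : H1dot, ∫ x, toL2 u x * ∑ i, perpGrad (stream u) i x * grad φ i x ∂μ =
      flux u u φ := by
    intro φ
    simp only [Finset.mul_sum]
    rw [integral_finsetSum _ fun i _ => hint φ i, flux_apply]
    refine Finset.sum_congr rfl fun i _ => ?_
    rw [perpGrad_stream]
    exact (inner_prod _ _ _).2.symm
  have hint' : ∀ φ : H1dot, Integrable (fun x => toL2 u x *
      ∑ i, perpGrad (stream u) i x * grad φ i x) μ := by
    intro φ
    simp only [Finset.mul_sum]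
    exact integrable_finsetSum _ fun i _ => hint φ i
  constructor
  · intro h
    refine ContinuousLinearMap.ext fun φ => ?_
    rw [(h φ).2, hval]
    rfl
  · rintro rfl φ
    refine ⟨hint' φ, ?_⟩
    rw [hval]
    rfl

lemma partialDeriv_mul_self {f : Torus → ℝ} (hf : IsSmooth f) (i : Fin 2) (x : Torus) :
    partialDeriv i (fun x => f x * f x) x = 2 * (f x * partialDeriv i f x) := by
  have h := hf.hasDerivAt i x 0
  have h2 := (h.mul h).deriv
  refine Eq.trans h2 ?_
  simp
  ring

/-- Energy cancellation: `∫ u v · ∇u = ½ ∫ v · ∇(u²) = 0` since `div v = 0`. For smooth `u` the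
square `u²` is a test function; the general case follows by density. -/
lemma flux_self (u w : H1dot) : flux u w u = 0 := by
  have hcont : Continuous fun u : H1dot => flux u w u :=
    (flux.continuous.clm_apply continuous_const).clm_apply continuous_id
  have hclosed : IsClosed {u : H1dot | flux u w u = 0} := isClosed_eq hcont continuous_const
  refine hclosed.closure_subset_iff.2 (fun u hu => ?_) (dense_smoothH1 u)
  obtain ⟨f, hf, h0, rfl⟩ := exists_ofSmooth_of_mem hu
  rw [Set.mem_ofPred_eq, flux_apply]
  have hi : ∀ i, inner ℝ (prod (ofSmooth f hf h0) (velocity i w)) (grad (ofSmooth f hf h0) i) =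
      -(1 / 2) * ∫ x, grad (velocity i w) i x * (f x * f x) ∂μ := by
    intro i
    have h1 := isWeakDeriv_grad (velocity i w) i _ (hf.mul hf)
    rw [(inner_prod _ _ _).2, neg_mul, ← mul_neg, ← h1, ← integral_const_mul]
    refine integral_congr_ae ?_
    filter_upwards [coeFn_toL2_ofSmooth hf h0, coeFn_grad_ofSmooth hf h0 i] with x hx hx'
    rw [hx, hx', partialDeriv_mul_self hf]
    ring
  rw [Finset.sum_congr rfl fun i _ => hi i, Fin.sum_univ_two, ← mul_add, ← integral_add
    (integrable_mul _ (hf.mul hf).continuous) (integrable_mul _ (hf.mul hf).continuous)]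
  have hz : ∫ x, (grad (velocity 0 w) 0 x * (f x * f x) +
      grad (velocity 1 w) 1 x * (f x * f x)) ∂μ = 0 := by
    refine integral_eq_zero_of_ae ?_
    have hsum := Lp.coeFn_add (grad (velocity 0 w) 0) (grad (velocity 1 w) 1)
    rw [div_velocity] at hsum
    filter_upwards [hsum, Lp.coeFn_zero ℝ 2 μ] with x hx hx'
    rw [hx', Pi.zero_apply, Pi.add_apply] at hx
    rw [← add_mul, ← hx, zero_mul, Pi.zero_apply]
  rw [hz, mul_zero]

/-! ### The Helmholtz operator -/

lemma helmholtz_self_ge (α : ℝ) (u : H1dot) : min 1 (α ^ 2) * ‖u‖ ^ 2 ≤ helmholtz α u u := by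
  rw [helmholtz_apply, real_inner_self_eq_norm_sq, real_inner_self_eq_norm_sq,
    ← real_inner_self_eq_norm_sq u, inner_H1dot, real_inner_self_eq_norm_sq,
    real_inner_self_eq_norm_sq, mul_add]
  gcongr
  · exact mul_le_of_le_one_left (sq_nonneg _) (min_le_left _ _)
  · exact min_le_right _ _

lemma helmholtz_comm (α : ℝ) (u w : H1dot) : helmholtz α u w = helmholtz α w u := by
  rw [helmholtz_apply, helmholtz_apply, real_inner_comm, real_inner_comm (grad w)]

lemma min_one_sq_pos {α : ℝ} (hα : 0 < α) : 0 < min 1 (α ^ 2) := lt_min one_pos (by positivity)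

lemma isCoercive_helmholtz {α : ℝ} (hα : 0 < α) : IsCoercive (E := H1dot) (helmholtz α) :=
  ⟨min 1 (α ^ 2), min_one_sq_pos hα, fun u => by
    have := helmholtz_self_ge α u
    rw [mul_assoc, ← sq]
    exact this⟩

lemma injective_helmholtz {α : ℝ} (hα : 0 < α) : Function.Injective (helmholtz α) := by
  refine (injective_iff_map_eq_zero _).2 fun u hu => ?_
  have h := helmholtz_self_ge α u
  rw [hu, zero_apply] at h
  have h2 : ‖u‖ ^ 2 ≤ 0 := nonpos_of_mul_nonpos_right h (min_one_sq_pos hα)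
  exact norm_eq_zero.1 (pow_eq_zero_iff two_ne_zero |>.1 (le_antisymm h2 (sq_nonneg _)))

lemma surjective_helmholtz {α : ℝ} (hα : 0 < α) : Function.Surjective (helmholtz α) := by
  intro F
  refine ⟨(isCoercive_helmholtz hα).continuousLinearEquivOfBilin.symm
    ((InnerProductSpace.toDual ℝ H1dot).symm F), ContinuousLinearMap.ext fun w => ?_⟩
  have h := (isCoercive_helmholtz hα).continuousLinearEquivOfBilin_apply
    ((isCoercive_helmholtz hα).continuousLinearEquivOfBilin.symm
      ((InnerProductSpace.toDual ℝ H1dot).symm F)) w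
  rw [ContinuousLinearEquiv.apply_symm_apply, InnerProductSpace.toDual_symm_apply] at h
  exact h.symm

/-- The isomorphism `1 - α² Δ : Ḣ¹ → Ḣ⁻¹`. -/
def helmholtzEquiv {α : ℝ} (hα : 0 < α) : H1dot ≃L[ℝ] Hm1dot :=
  ContinuousLinearEquiv.ofBijective (helmholtz α)
    (LinearMap.ker_eq_bot.2 (injective_helmholtz hα))
    (LinearMap.range_eq_top.2 (surjective_helmholtz hα))

/-- The bilinear map `(u, w) ↦ -(1 - α² Δ)⁻¹ div (u v)` with `v = ∇^⊥ (-Δ)^{-1/2} w`. -/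
def nonlinearity {α : ℝ} (hα : 0 < α) : H1dot →L[ℝ] H1dot →L[ℝ] H1dot :=
  (ContinuousLinearMap.compL ℝ H1dot Hm1dot H1dot
    (helmholtzEquiv hα).symm.toContinuousLinearMap).comp flux

lemma helmholtz_nonlinearity {α : ℝ} (hα : 0 < α) (u w : H1dot) :
    helmholtz α (nonlinearity hα u w) = flux u w :=
  (helmholtzEquiv hα).apply_symm_apply (flux u w)

lemma energy_eq (α : ℝ) (u : H1dot) : energy α u = helmholtz α u u := by
  have h : ∀ w : L2, Integrable (fun x => w x ^ 2) μ ∧ inner ℝ w w = ∫ x, w x ^ 2 ∂μ := by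
    intro w
    have e : (fun x => inner ℝ (w x) (w x)) = fun x => w x ^ 2 := by
      funext x
      simp [sq]
    rw [L2.inner_def, ← e]
    exact ⟨L2.integrable_inner (𝕜 := ℝ) w w, rfl⟩
  have hs : Integrable (fun x => ∑ i, grad u i x ^ 2) μ :=
    integrable_finsetSum _ fun i _ => (h (grad u i)).1
  rw [energy, integral_add (h (toL2 u)).1 (hs.const_mul _), integral_const_mul,
    integral_finsetSum _ fun i _ => (h (grad u i)).1, helmholtz_apply, PiLp.inner_apply,
    (h (toL2 u)).2]
  simp only [(h (grad u _)).2]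

/-! ### Quadratic differential equations with a conserved energy -/

section ODE

variable {E : Type*} [NormedAddCommGroup E]

/-- A Lipschitz cutoff function which is `1` on the ball of radius `R` and `0` outside the ball of
radius `R + 1`. -/
def cutoff (R : ℝ) (x : E) : ℝ := max 0 (min 1 (R + 1 - ‖x‖))

lemma cutoff_nonneg (R : ℝ) (x : E) : 0 ≤ cutoff R x := le_max_left _ _

lemma cutoff_le_one (R : ℝ) (x : E) : cutoff R x ≤ 1 := max_le zero_le_one (min_le_left _ _)

lemma cutoff_eq_one {R : ℝ} {x : E} (h : ‖x‖ ≤ R) : cutoff R x = 1 := by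
  rw [cutoff, min_eq_left (by linarith), max_eq_right zero_le_one]

lemma cutoff_eq_zero {R : ℝ} {x : E} (h : R + 1 ≤ ‖x‖) : cutoff R x = 0 :=
  max_eq_left ((min_le_right _ _).trans (by linarith))

lemma abs_cutoff_sub_le (R : ℝ) (x y : E) : |cutoff R x - cutoff R y| ≤ ‖x - y‖ := by
  refine (abs_max_sub_max_le_max _ _ _ _).trans ?_
  rw [sub_self, abs_zero]
  refine max_le (norm_nonneg _) ((abs_min_sub_min_le_max _ _ _ _).trans ?_)
  rw [sub_self, abs_zero]
  refine max_le (norm_nonneg _) ?_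
  rw [sub_sub_sub_cancel_left, abs_sub_comm]
  exact abs_norm_sub_norm_le x y

variable [NormedSpace ℝ E]

/-- A bounded Lipschitz vector field has global integral curves. As the field is bounded by `L`, the
Picard-Lindelöf theorem on the ball of radius `L T` yields a solution on `[-T, T]`, for each `T`;
these solutions agree where they are defined. -/
lemma exists_integralCurve_of_lipschitz [CompleteSpace E] {f : E → E} {K L : NNReal}
    (hf : LipschitzWith K f) (hL : ∀ x, ‖f x‖ ≤ L) (x₀ : E) :
    ∃ x : ℝ → E, x 0 = x₀ ∧ ∀ t, HasDerivAt x (f (x t)) t := by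
  have hloc : ∀ n : ℕ, ∃ x : ℝ → E, x 0 = x₀ ∧
      ∀ t ∈ Set.Ioo (-((n : ℝ) + 1)) ((n : ℝ) + 1), HasDerivAt x (f (x t)) t := by
    intro n
    have h0 : (0 : ℝ) ∈ Set.Icc (-((n : ℝ) + 1)) ((n : ℝ) + 1) := by
      constructor <;> linarith [(n.cast_nonneg : (0 : ℝ) ≤ n)]
    have hPL : IsPicardLindelof (fun _ => f) (tmin := -((n : ℝ) + 1)) (tmax := (n : ℝ) + 1)
        ⟨0, h0⟩ x₀ (L * (n + 1)) 0 L K :=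
      { lipschitzOnWith := fun t _ => hf.lipschitzOnWith
        continuousOn := fun x _ => continuousOn_const
        norm_le := fun t _ x _ => hL x
        mul_max_le := by simp }
    obtain ⟨x, hx0, hx⟩ := hPL.exists_eq_forall_mem_Icc_hasDerivWithinAt₀
    exact ⟨x, hx0, fun t ht => (hx t (Set.Ioo_subset_Icc_self ht)).hasDerivAt
      (Icc_mem_nhds ht.1 ht.2)⟩
  choose x hx0 hx using hloc
  have hmono : ∀ n m : ℕ, n ≤ m → Set.EqOn (x n) (x m)
      (Set.Ioo (-((n : ℝ) + 1)) ((n : ℝ) + 1)) := by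
    intro n m hnm
    have hnm' : (n : ℝ) ≤ m := by exact_mod_cast hnm
    have hn : (0 : ℝ) ≤ n := n.cast_nonneg
    refine ODE_solution_unique_of_mem_Ioo (v := fun _ => f) (s := fun _ => Set.univ) (K := K)
      (t₀ := 0) (fun _ _ => hf.lipschitzOnWith) ⟨by linarith, by linarith⟩
      (fun t ht => ⟨hx n t ht, trivial⟩) (fun t ht => ⟨hx m t ⟨?_, ?_⟩, trivial⟩)
      ((hx0 n).trans (hx0 m).symm)
    · linarith [ht.1]
    · linarith [ht.2]
  have hmem : ∀ t : ℝ, t ∈ Set.Ioo (-((⌈|t|⌉₊ : ℝ) + 1)) ((⌈|t|⌉₊ : ℝ) + 1) := by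
    intro t
    refine abs_lt.1 ?_
    linarith [Nat.le_ceil |t|]
  refine ⟨fun t => x ⌈|t|⌉₊ t, hx0 _, fun t => ?_⟩
  refine (hx _ t (hmem t)).congr_of_eventuallyEq ?_
  filter_upwards [Ioo_mem_nhds (hmem t).1 (hmem t).2] with s hs
  rcases le_total ⌈|s|⌉₊ ⌈|t|⌉₊ with h | h
  · exact hmono _ _ h (hmem s)
  · exact (hmono _ _ h hs).symm

lemma norm_quadratic_sub_le (B : E →L[ℝ] E →L[ℝ] E) (x y : E) :
    ‖B x x - B y y‖ ≤ ‖B‖ * (‖x‖ + ‖y‖) * ‖x - y‖ := by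
  have h : B x x - B y y = B (x - y) x + B y (x - y) := by
    simp
  calc ‖B x x - B y y‖ ≤ ‖B (x - y) x‖ + ‖B y (x - y)‖ := by rw [h]; exact norm_add_le _ _
    _ ≤ ‖B‖ * ‖x - y‖ * ‖x‖ + ‖B‖ * ‖y‖ * ‖x - y‖ :=
      add_le_add (B.le_opNorm₂ _ _) (B.le_opNorm₂ _ _)
    _ = _ := by ring

lemma norm_cutoff_smul_le (B : E →L[ℝ] E →L[ℝ] E) {R : ℝ} (hR : 0 ≤ R) (x : E) :
    ‖cutoff R x • B x x‖ ≤ ‖B‖ * (R + 1) ^ 2 := by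
  rcases le_total (R + 1) ‖x‖ with h | h
  · rw [cutoff_eq_zero h, zero_smul, norm_zero]
    positivity
  · rw [norm_smul, Real.norm_of_nonneg (cutoff_nonneg R x)]
    calc cutoff R x * ‖B x x‖ ≤ 1 * (‖B‖ * ‖x‖ * ‖x‖) :=
          mul_le_mul (cutoff_le_one R x) (B.le_opNorm₂ _ _) (norm_nonneg _) zero_le_one
      _ = ‖B‖ * ‖x‖ ^ 2 := by ring
      _ ≤ _ := by gcongr

lemma norm_cutoff_smul_sub_le (B : E →L[ℝ] E →L[ℝ] E) {R : ℝ} (hR : 0 ≤ R) (x y : E) :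
    ‖cutoff R x • B x x - cutoff R y • B y y‖ ≤
      (‖B‖ * (R + 1) ^ 2 + 2 * ‖B‖ * (R + 1)) * ‖x - y‖ := by
  have key : ∀ x y : E, ‖x‖ ≤ R + 1 → ‖cutoff R x • B x x - cutoff R y • B y y‖ ≤
      (‖B‖ * (R + 1) ^ 2 + 2 * ‖B‖ * (R + 1)) * ‖x - y‖ := by
    intro x y hx
    have h : cutoff R x • B x x - cutoff R y • B y y =
        (cutoff R x - cutoff R y) • B x x + cutoff R y • (B x x - B y y) := by
      rw [sub_smul, smul_sub]
      abel
    have h1 : ‖(cutoff R x - cutoff R y) • B x x‖ ≤ ‖B‖ * (R + 1) ^ 2 * ‖x - y‖ := by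
      rw [norm_smul, Real.norm_eq_abs]
      calc |cutoff R x - cutoff R y| * ‖B x x‖ ≤ ‖x - y‖ * (‖B‖ * ‖x‖ * ‖x‖) :=
            mul_le_mul (abs_cutoff_sub_le R x y) (B.le_opNorm₂ _ _) (norm_nonneg _) (norm_nonneg _)
        _ = ‖B‖ * ‖x‖ ^ 2 * ‖x - y‖ := by ring
        _ ≤ _ := by gcongr
    have h2 : ‖cutoff R y • (B x x - B y y)‖ ≤ 2 * ‖B‖ * (R + 1) * ‖x - y‖ := by
      rcases le_total (R + 1) ‖y‖ with hy | hy
      · rw [cutoff_eq_zero hy, zero_smul, norm_zero]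
        positivity
      · rw [norm_smul, Real.norm_of_nonneg (cutoff_nonneg R y)]
        calc cutoff R y * ‖B x x - B y y‖ ≤ 1 * (‖B‖ * (‖x‖ + ‖y‖) * ‖x - y‖) :=
              mul_le_mul (cutoff_le_one R y) (norm_quadratic_sub_le B x y) (norm_nonneg _)
                zero_le_one
          _ ≤ 1 * (‖B‖ * ((R + 1) + (R + 1)) * ‖x - y‖) := by gcongr
          _ = _ := by ring
    rw [h, add_mul]
    exact (norm_add_le _ _).trans (add_le_add h1 h2)
  rcases le_total ‖x‖ (R + 1) with hx | hx
  · exact key x y hx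
  rcases le_total ‖y‖ (R + 1) with hy | hy
  · rw [norm_sub_rev, norm_sub_rev x y]
    exact key y x hy
  · rw [cutoff_eq_zero hx, cutoff_eq_zero hy, zero_smul, zero_smul, sub_zero, norm_zero]
    positivity

variable {B : E →L[ℝ] E →L[ℝ] E} {a : E →L[ℝ] E →L[ℝ] ℝ}

/-- Multiplying the field by a scalar function does not affect the conservation of the energy. -/
lemma energy_const (hsymm : ∀ x y, a x y = a y x) (hcancel : ∀ x, a (B x x) x = 0)
    {g : ℝ → ℝ} {x : ℝ → E} (hx : ∀ t, HasDerivAt x (g t • B (x t) (x t)) t) (t s : ℝ) :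
    a (x t) (x t) = a (x s) (x s) := by
  have h : ∀ t, HasDerivAt (fun t => a (x t) (x t)) 0 t := by
    intro t
    have h1 := ((a.hasFDerivAt (x := x t)).comp_hasDerivAt t (hx t)).clm_apply (hx t)
    refine h1.congr_deriv ?_
    rw [Function.comp_apply, hsymm (x t), map_smul, smul_apply, hcancel, smul_zero,
      add_zero]
  exact is_const_of_deriv_eq_zero (fun t => (h t).differentiableAt) (fun t => (h t).deriv) t s

/-- The a priori bound given by a coercive conserved energy. -/
lemma norm_le_of_energy_eq {c : ℝ} (hc : 0 < c) (hcoer : ∀ x, c * ‖x‖ ^ 2 ≤ a x x) {x y : E}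
    (h : a x x = a y y) : ‖x‖ ≤ √(a y y / c) := by
  refine Real.le_sqrt_of_sq_le ?_
  rw [le_div_iff₀ hc, mul_comm, ← h]
  exact hcoer x

/-- A solution of the equation with cutoff at the radius of the a priori bound stays in the ball
where the cutoff function is `1`, and so solves the equation without cutoff. -/
lemma exists_global_solution [CompleteSpace E] {c : ℝ} (hc : 0 < c)
    (hcoer : ∀ x, c * ‖x‖ ^ 2 ≤ a x x) (hsymm : ∀ x y, a x y = a y x)
    (hcancel : ∀ x, a (B x x) x = 0) (x₀ : E) :
    ∃ x : ℝ → E, x 0 = x₀ ∧ ∀ t, HasDerivAt x (B (x t) (x t)) t := by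
  set R : ℝ := √(a x₀ x₀ / c) with hR
  have hR0 : 0 ≤ R := Real.sqrt_nonneg _
  have hlip : LipschitzWith (Real.toNNReal (‖B‖ * (R + 1) ^ 2 + 2 * ‖B‖ * (R + 1)))
      fun x => cutoff R x • B x x := by
    refine LipschitzWith.of_dist_le_mul fun x y => ?_
    rw [Real.coe_toNNReal _ (by positivity), dist_eq_norm, dist_eq_norm]
    exact norm_cutoff_smul_sub_le B hR0 x y
  obtain ⟨x, hx0, hx⟩ := exists_integralCurve_of_lipschitz hlip
    (L := Real.toNNReal (‖B‖ * (R + 1) ^ 2)) (fun x => by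
      rw [Real.coe_toNNReal _ (by positivity)]
      exact norm_cutoff_smul_le B hR0 x) x₀
  refine ⟨x, hx0, fun t => ?_⟩
  have hE := energy_const hsymm hcancel (g := fun t => cutoff R (x t)) hx t 0
  rw [hx0] at hE
  have h := hx t
  rwa [cutoff_eq_one (norm_le_of_energy_eq hc hcoer hE), one_smul] at h

lemma solution_unique {c : ℝ} (hc : 0 < c)
    (hcoer : ∀ x, c * ‖x‖ ^ 2 ≤ a x x) (hsymm : ∀ x y, a x y = a y x)
    (hcancel : ∀ x, a (B x x) x = 0) {x y : ℝ → E}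
    (hx : ∀ t, HasDerivAt x (B (x t) (x t)) t) (hy : ∀ t, HasDerivAt y (B (y t) (y t)) t)
    (h0 : x 0 = y 0) : x = y := by
  set R : ℝ := √(a (x 0) (x 0) / c) with hR
  have hR0 : 0 ≤ R := Real.sqrt_nonneg _
  have hball : ∀ z : ℝ → E, (∀ t, HasDerivAt z (B (z t) (z t)) t) → z 0 = x 0 →
      ∀ t, z t ∈ Metric.closedBall (0 : E) R := by
    intro z hz hz0 t
    have hE := energy_const hsymm hcancel (g := fun _ => 1) (by simpa using hz) t 0
    rw [hz0] at hE
    rw [mem_closedBall_zero_iff]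
    exact norm_le_of_energy_eq hc hcoer hE
  have hlip : LipschitzOnWith (Real.toNNReal (‖B‖ * (R + R))) (fun x => B x x)
      (Metric.closedBall (0 : E) R) := by
    refine LipschitzOnWith.of_dist_le_mul fun u hu w hw => ?_
    rw [mem_closedBall_zero_iff] at hu hw
    rw [Real.coe_toNNReal _ (by positivity), dist_eq_norm, dist_eq_norm]
    refine (norm_quadratic_sub_le B u w).trans ?_
    gcongr
  exact ODE_solution_unique_univ (v := fun _ x => B x x) (s := fun _ => Metric.closedBall (0 : E) R)
    (fun _ => hlip) (fun t => ⟨hx t, hball x hx rfl t⟩) (fun t => ⟨hy t, hball y hy h0.symm t⟩) h0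

end ODE

/-! ### Solutions of the regularized equations -/

/-- A solution `θ` of `θ' = nonlinearity θ θ` determines a solution of the full system. -/
lemma isSolution_of_hasDerivAt {α : ℝ} (hα : 0 < α) {θ₀ : H1dot} {θ : ℝ → H1dot} (h0 : θ 0 = θ₀)
    (hθ : ∀ t, HasDerivAt θ (nonlinearity hα (θ t) (θ t)) t) :
    IsSolution α θ₀ θ (fun t => helmholtz α (θ t)) (fun t => stream (θ t))
      (fun t => perpGrad (stream (θ t))) where
  helmholtz_eq _ := rfl
  evolution t := by
    refine ⟨-flux (θ t) (θ t), (isDiv_iff _ _).2 rfl, ?_⟩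
    rw [neg_neg, ← helmholtz_nonlinearity hα]
    exact (helmholtz α).hasFDerivAt.comp_hasDerivAt t (hθ t)
  velocity _ := rfl
  stream _ := (isHalfLaplacian_iff _ _).2 rfl
  initial := h0

/-- Every solution of the full system arises from a solution of `θ' = nonlinearity θ θ`. -/
lemma IsSolution.hasDerivAt {α : ℝ} (hα : 0 < α) {θ₀ : H1dot} {θ : ℝ → H1dot} {θt : ℝ → Hm1dot}
    {ψ : ℝ → H1dot} {v : ℝ → L2Vec} (h : IsSolution α θ₀ θ θt ψ v) :
    (∀ t, HasDerivAt θ (nonlinearity hα (θ t) (θ t)) t) ∧ (∀ t, θt t = helmholtz α (θ t)) ∧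
      (∀ t, ψ t = SQG.stream (θ t)) ∧ ∀ t, v t = perpGrad (SQG.stream (θ t)) := by
  have hψ : ∀ t, ψ t = SQG.stream (θ t) := fun t => (isHalfLaplacian_iff _ _).1 (h.stream t)
  have hv : ∀ t, v t = perpGrad (SQG.stream (θ t)) := fun t => by rw [h.velocity, hψ]
  refine ⟨fun t => ?_, fun t => (h.helmholtz_eq t).symm, hψ, hv⟩
  obtain ⟨F, hF, hd⟩ := h.evolution t
  rw [hv] at hF
  rw [(isDiv_iff _ _).1 hF, neg_neg] at hd
  have h1 := ((helmholtzEquiv hα).symm.toContinuousLinearMap).hasFDerivAt.comp_hasDerivAt t hd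
  have h2 : (helmholtzEquiv hα).symm.toContinuousLinearMap ∘ θt = θ := by
    funext s
    change (helmholtzEquiv hα).symm (θt s) = θ s
    rw [← h.helmholtz_eq s]
    exact (helmholtzEquiv hα).symm_apply_apply (θ s)
  rw [h2] at h1
  exact h1

lemma contDiff_one_of_hasDerivAt {E : Type*} [NormedAddCommGroup E] [NormedSpace ℝ E]
    {B : E →L[ℝ] E →L[ℝ] E} {x : ℝ → E} (hx : ∀ t, HasDerivAt x (B (x t) (x t)) t) :
    ContDiff ℝ 1 x := by
  have hd : Differentiable ℝ x := fun t => (hx t).differentiableAt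
  refine contDiff_one_iff_deriv.2 ⟨hd, ?_⟩
  rw [funext fun t => (hx t).deriv]
  exact (B.continuous.comp hd.continuous).clm_apply hd.continuous

lemma contDiff_helmholtz_comp (α : ℝ) {θ : ℝ → H1dot} (hθ : ContDiff ℝ 1 θ) :
    ContDiff ℝ 1 fun t => helmholtz α (θ t) :=
  (helmholtz α).contDiff.comp hθ

end SQG

end

/-- Global existence, uniqueness, regularity in time and conservation of the modified energy for
the regularized surface quasi-geostrophic equations on the torus. -/
theorem theorem1 (α : ℝ) (hα : 0 < α) (θ₀ : SQG.H1dot) :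
    ∃ (θ : ℝ → SQG.H1dot) (θt : ℝ → SQG.Hm1dot) (ψ : ℝ → SQG.H1dot) (v : ℝ → SQG.L2Vec),
      SQG.IsSolution α θ₀ θ θt ψ v ∧
      ContDiff ℝ 1 θ ∧
      ContDiff ℝ 1 θt ∧
      (∀ t, SQG.energy α (θ t) = SQG.energy α θ₀) ∧
      ∀ (θ' : ℝ → SQG.H1dot) (θt' : ℝ → SQG.Hm1dot) (ψ' : ℝ → SQG.H1dot) (v' : ℝ → SQG.L2Vec),
        SQG.IsSolution α θ₀ θ' θt' ψ' v' → θ' = θ ∧ θt' = θt ∧ ψ' = ψ ∧ v' = v := by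
  open SQG in
  have hcancel : ∀ u, helmholtz α (nonlinearity hα u u) u = 0 := fun u => by
    rw [helmholtz_nonlinearity]
    exact flux_self u u
  obtain ⟨θ, h0, hθ⟩ := exists_global_solution (B := nonlinearity hα) (a := helmholtz α)
    (min_one_sq_pos hα) (helmholtz_self_ge α) (helmholtz_comm α) hcancel θ₀
  have hC : ContDiff ℝ 1 θ := contDiff_one_of_hasDerivAt hθ
  refine ⟨θ, _, _, _, isSolution_of_hasDerivAt hα h0 hθ, hC, contDiff_helmholtz_comp α hC,
    fun t => ?_, fun θ' θt' ψ' v' h' => ?_⟩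
  · rw [energy_eq, energy_eq, ← h0]
    exact energy_const (B := nonlinearity hα) (a := helmholtz α) (helmholtz_comm α) hcancel
      (g := fun _ => 1) (fun t => by rw [one_smul]; exact hθ t) t 0
  · obtain ⟨hd, hθt, hψ, hv⟩ := h'.hasDerivAt hα
    have hu : θ' = θ := solution_unique (B := nonlinearity hα) (a := helmholtz α)
      (min_one_sq_pos hα) (helmholtz_self_ge α) (helmholtz_comm α) hcancel hd hθ
      (h'.initial.trans h0.symm)
    subst hu
    exact ⟨rfl, funext hθt, funext hψ, funext hv⟩
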